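/- Let $n,d\ge 1$ be integers, let $K$ be a field of characteristic zero, and let $S=K[X_1,\dots,X_n]$ with its standard grading and irrelevant ideal $S_+=\langle X_1,\dots,X_n\rangle$. Write $\mathbb{N}=\{0,1,2,\dots\}$, $\mathbb{N}^n_d=\{a\in\mathbb{N}^n : a_1+\dots+a_n=d\}$, and let $e_1,\dots,e_n$ be the standard basis vectors of $\mathbb{Z}^n$. For $a,b\in\mathbb{N}^n_d$ write $a\ge_{\mathrm{Bor}} b$ if $a-b=\sum_{j=1}^{n-1}\alpha_j(e_j-e_{j+1})$ for some $\alpha_1,\dots,\alpha_{n-1}\in\mathbb{N}$. A subset $B\subseteq\mathbb{N}^n_d$ is called a Borel set if $a\in B$, $b\in\mathbb{N}^n_d$ and $b\ge_{\mathrm{Bor}}a$ imply $b\in B$. A binomial system (of degree $d$ in $n$ indeterminates) is a triple $(A,C,\rho)$ with $A,C\subseteq\mathbb{N}^n_d$ and $\rho\in\mathbb{Z}^n$ such that $C+\rho\subseteq\mathbb{N}^n_d$, the sets $A$, $C$, $C+\rho$ are pairwise disjoint, and $A\cup C$ and $A\cup(C+\rho)$ are Borel sets. Put $m(\rho)=\max(\{i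 : \rho_i\ne 0\}\cup\{1\})$. The system is admissible if $C=\emptyset$ or $\rho_{m(\rho)}>0$. Put $$F(A,C,\rho)=\langle\, X^a,\ X^c-X^{c+\rho} : a\in A,\ c\in C\,\rangle\subseteq S,\qquad F(A,C,\rho)^{\mathrm{sat}}=\bigcup_{k\ge 0}\bigl(F(A,C,\rho):S_+^k\bigr).$$ A finitely generated $S$-module $M$ is Cohen–Macaulay if $\operatorname{depth} M_{\mathfrak m}=\dim M_{\mathfrak m}$ for every maximal ideal $\mathfrak m$ in the support of $M$. A finitely generated graded $S$-module $M$ is sequentially Cohen–Macaulay if it has a finite filtration $0=M_0\subsetneq M_1\subsetneq\dots\subsetneq M_r=M$, $r\ge 0$, by graded submodules such that $M_i/M_{i-1}$ is Cohen–Macaulay for all $1\le i\le r$ and $\dim(M_i/M_{i-1})<\dim(M_{i+1}/M_i)$ for all $1\le i<r$. **Theorem.** Let $(A,C,\rho)$ be an admissible binomial system. Then the graded $S$-modules $S/F(A,C,\rho)^{\mathrm{sat}}$ and $S/F(A,C,\rho)$ are sequentially Cohen–Macaulay. -/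

import Mathlib

noncomputable section

namespace BinomialIdeals

/-! ### Cohen–Macaulay and sequentially Cohen–Macaulay modules -/

/-- The depth of a module over a local ring `(R, 𝔪)`: the supremum of the lengths of the
`M`-regular sequences contained in `𝔪`. -/
def depth (R M : Type*) [CommRing R] [IsLocalRing R] [AddCommGroup M] [Module R M] : ℕ∞ :=
  ⨆ (rs : List R) (_ : (∀ r ∈ rs, r ∈ IsLocalRing.maximalIdeal R) ∧
    RingTheory.Sequence.IsRegular M rs), (rs.length : ℕ∞)

/-- A (finitely generated) module `M` over a (Noetherian) ring `R` is Cohen–Macaulay if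
`depth M_𝔪 = dim M_𝔪` for every maximal ideal `𝔪` in the support of `M`. -/
def IsCohenMacaulay (R M : Type*) [CommRing R] [AddCommGroup M] [Module R M] : Prop :=
  ∀ 𝔪 : PrimeSpectrum R, 𝔪.asIdeal.IsMaximal → 𝔪 ∈ Module.support R M →
    (depth (Localization.AtPrime 𝔪.asIdeal)
        (LocalizedModule 𝔪.asIdeal.primeCompl M) : WithBot ℕ∞) =
      Module.supportDim (Localization.AtPrime 𝔪.asIdeal)
        (LocalizedModule 𝔪.asIdeal.primeCompl M)

/-- The subquotient `P / N` of a module, for submodules `N ≤ P`. -/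
abbrev Subquotient {R M : Type*} [CommRing R] [AddCommGroup M] [Module R M]
    (P N : Submodule R M) : Type _ :=
  P ⧸ N.submoduleOf P

/-- A submodule is graded if it is generated by homogeneous elements. -/
def IsGradedSubmodule {ι R M σ : Type*} [CommRing R] [AddCommGroup M] [Module R M]
    [SetLike σ M] (ℳ : ι → σ) (N : Submodule R M) : Prop :=
  Submodule.span R {x : M | x ∈ N ∧ SetLike.IsHomogeneousElem ℳ x} = N

/-- `M` with the homogeneous parts `ℳ i` is a finitely generated graded module over the graded ring
`R = ⨁ 𝒜 i`, and it is sequentially Cohen–Macaulay: there is a finite filtration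
`0 = N 0 ⊊ N 1 ⊊ ⋯ ⊊ N r = M` by graded submodules with Cohen–Macaulay quotients of strictly
increasing dimension. -/
structure IsSequentiallyCohenMacaulay {ι R M σ τ : Type*} [DecidableEq ι] [AddMonoid ι]
    [CommRing R] [AddCommGroup M] [Module R M] [SetLike σ R] [AddSubmonoidClass σ R]
    [SetLike τ M] [AddSubmonoidClass τ M] (𝒜 : ι → σ) [GradedRing 𝒜] (ℳ : ι → τ) : Prop where
  finite : Module.Finite R M
  isInternal : DirectSum.IsInternal ℳ
  smul_mem : ∀ ⦃i j : ι⦄ ⦃a : R⦄ ⦃m : M⦄, a ∈ 𝒜 i → m ∈ ℳ j → a • m ∈ ℳ (i + j)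
  exists_filtration : ∃ (r : ℕ) (N : ℕ → Submodule R M),
    N 0 = ⊥ ∧ N r = ⊤ ∧
    (∀ i < r, N i < N (i + 1)) ∧
    (∀ i ≤ r, IsGradedSubmodule ℳ (N i)) ∧
    (∀ i < r, IsCohenMacaulay R (Subquotient (N (i + 1)) (N i))) ∧
    (∀ i, i + 1 < r → Module.supportDim R (Subquotient (N (i + 1)) (N i)) <
      Module.supportDim R (Subquotient (N (i + 2)) (N (i + 1))))

/-! ### Borel sets and binomial systems -/

variable {n : ℕ}

/-- The set of exponent vectors `a ∈ ℕⁿ` with `a₁ + ⋯ + aₙ = d`. -/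
def vectorsOfDegree (n d : ℕ) : Set (Fin n →₀ ℕ) := {a | ∑ i, a i = d}

/-- The standard basis vector of `ℤⁿ` with the entry `1` at the (zero-based) position `k`. -/
def stdVec (n k : ℕ) : Fin n → ℤ := fun i => if (i : ℕ) = k then 1 else 0

/-- The Borel order `a ≥ b`: the difference `a - b` is a combination of the vectors
`eⱼ - eⱼ₊₁`, `1 ≤ j < n`, with nonnegative integer coefficients. -/
def BorelGE (a b : Fin n →₀ ℕ) : Prop :=
  ∃ α : ℕ → ℕ, ∀ i : Fin n,
    (a i : ℤ) - (b i : ℤ) =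
      ∑ k ∈ Finset.range (n - 1), (α k : ℤ) * (stdVec n k i - stdVec n (k + 1) i)

/-- Borel sets of degree `d` in `n` indeterminates. -/
def IsBorelSet (d : ℕ) (B : Set (Fin n →₀ ℕ)) : Prop :=
  B ⊆ vectorsOfDegree n d ∧
    ∀ a ∈ B, ∀ b ∈ vectorsOfDegree n d, BorelGE b a → b ∈ B

/-- `b = c + ρ` as vectors in `ℤⁿ`. -/
def IsTranslate (ρ : Fin n → ℤ) (c b : Fin n →₀ ℕ) : Prop :=
  ∀ i, (b i : ℤ) = (c i : ℤ) + ρ i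

/-- The set of all `b ∈ ℕⁿ` of the form `c + ρ` with `c ∈ C`; it is `C + ρ` whenever
`C + ρ ⊆ ℕⁿ`. -/
def translate (C : Set (Fin n →₀ ℕ)) (ρ : Fin n → ℤ) : Set (Fin n →₀ ℕ) :=
  {b | ∃ c ∈ C, IsTranslate ρ c b}

/-- Binomial systems `(A, C, ρ)` of degree `d` in `n` indeterminates. -/
structure IsBinomialSystem (d : ℕ) (A C : Set (Fin n →₀ ℕ)) (ρ : Fin n → ℤ) : Prop where
  subset_left : A ⊆ vectorsOfDegree n d
  subset_right : C ⊆ vectorsOfDegree n d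
  translate_mem : ∀ c ∈ C, ∃ b ∈ vectorsOfDegree n d, IsTranslate ρ c b
  disjoint_left : A ∩ C = ∅
  disjoint_translate : A ∩ translate C ρ = ∅
  disjoint_right : C ∩ translate C ρ = ∅
  borel_left : IsBorelSet d (A ∪ C)
  borel_right : IsBorelSet d (A ∪ translate C ρ)

/-- The last position at which `ρ` does not vanish (the first position if `ρ = 0`). -/
def lastIndex [NeZero n] (ρ : Fin n → ℤ) : Fin n :=
  (insert 0 (Finset.univ.filter fun i => ρ i ≠ 0)).max' (Finset.insert_nonempty _ _)

/-- Admissible binomial systems. -/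
structure IsAdmissibleBinomialSystem [NeZero n] (d : ℕ) (A C : Set (Fin n →₀ ℕ))
    (ρ : Fin n → ℤ) : Prop extends IsBinomialSystem d A C ρ where
  admissible : C = ∅ ∨ 0 < ρ (lastIndex ρ)

/-! ### The ideals `F(A, C, ρ)` and `F(A, C, ρ)ˢᵃᵗ` -/

open MvPolynomial

variable (K : Type*) [Field K]

/-- `F(A, C, ρ)`: the ideal generated by the monomials `X ^ a`, `a ∈ A`, and the binomials
`X ^ c - X ^ (c + ρ)`, `c ∈ C`. -/
def binomialIdeal (A C : Set (Fin n →₀ ℕ)) (ρ : Fin n → ℤ) : Ideal (MvPolynomial (Fin n) K) :=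
  Ideal.span ({f | ∃ a ∈ A, f = monomial a 1} ∪
    {f | ∃ c ∈ C, ∃ b, IsTranslate ρ c b ∧ f = monomial c 1 - monomial b 1})

variable {K}

/-- The saturation `⋃ₖ (I : S₊ᵏ)` of an ideal with respect to the irrelevant ideal
`S₊ = (X₁, …, Xₙ)`. -/
def saturation (I : Ideal (MvPolynomial (Fin n) K)) : Ideal (MvPolynomial (Fin n) K) :=
  ⨆ k : ℕ, Submodule.colon I ((idealOfVars (Fin n) K ^ k : Ideal (MvPolynomial (Fin n) K)) :
    Set (MvPolynomial (Fin n) K))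

/-- The supremum in the definition of the saturation is a union. -/
theorem mem_saturation {I : Ideal (MvPolynomial (Fin n) K)} {f : MvPolynomial (Fin n) K} :
    f ∈ saturation I ↔ ∃ k : ℕ, ∀ g ∈ idealOfVars (Fin n) K ^ k, f * g ∈ I := by
  unfold saturation
  rw [Submodule.mem_iSup_of_directed]
  · simp [Submodule.mem_colon]
  · refine Monotone.directed_le fun k l h => Submodule.colon_mono le_rfl ?_
    exact Ideal.pow_le_pow_right h

/-- The homogeneous parts of `S / I`, the images of the homogeneous parts of the polynomial
ring `S` with its standard grading. -/
def quotientGrading (I : Ideal (MvPolynomial (Fin n) K)) (i : ℕ) :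
    Submodule K (MvPolynomial (Fin n) K ⧸ I) :=
  (homogeneousSubmodule (Fin n) K i).map (Ideal.Quotient.mkₐ K I).toLinearMap

end BinomialIdeals

end

attribute [local instance] MvPolynomial.gradedAlgebra

/-!
Let `S = K[X 0, …, X (n - 1)]`, let `m` be the last index of `ρ`, and let `F` be the ideal of an
admissible binomial system. Successive saturation of `F` with respect to the ideals
`(X 0, …, X (n - 1))`, `(X 0, …, X (n - 2))`, … gives an increasing chain of homogeneous ideals
`F = F n ≤ F (n - 1) ≤ ⋯ ≤ F 0 ≤ S`, and the subquotient `F (t - 1) / F t` is Cohen–Macaulay of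
dimension `n - t` or zero, where `F (-1) = S`. After the removal of repetitions the chain is the filtration wanted for
`S / F = S / F n`, and its part above `F (n - 1)`, which is the saturation of `F`, is the one wanted
for the saturation.

The chain is explicit (`partialSaturation`). For `t ≥ m` the ideal `F t` has the generators of `F`
with the variables at the positions `≥ t` set to one, the second terms of the binomials being
corrected by a power of `X m` if `t = m`; for `t < m` it is the monomial ideal that arises in the same
way from the monomials `X ^ b`, `b ∈ A ∪ C ∪ (C + ρ)`. Two facts about it are needed.

* A power of `X i` multiplies `F t` into `F (t + 1)` for each `i ≤ t`
  (`X_pow_mul_mem_partialSaturation`). In a Borel set the whole entry at `t` may be moved to `i`. If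
  the move takes `c ∈ C` to an element of `A`, then it takes `c + ρ` to an element of `A` as
  well, since the sets are disjoint. In the step to `t + 1 = m`, emptying the `m`-th entry takes
  `A ∪ (C + ρ)` into `A`, because `ρ` is positive at `m`.
* The variable `X t`, and each nonzero polynomial in it, is a nonzerodivisor modulo `F t`
  (`mem_partialSaturation_of_aeval_mul_mem`). This is clear for `t ≠ m`, where `X t` does not occur in
  the generators. For `t = m` the rewriting rules `X ^ a ↦ 0` and `X ^ c ↦ X ^ (c + ρ)` with truncated
  vectors are confluent by the combinatorial lemma `exists_trunc_le_translate`, so that `F m` is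
  the kernel of a normal form map that is linear over `K[X m]`.

As neither `F t` nor `F (t - 1)` involves the variables beyond `X t`, it follows that for arbitrary
nonzero univariate polynomials `p i` the sequence `p t (X t), …, p (n - 1) (X (n - 1))` is weakly
regular on `F (t - 1) / F t`. A maximal ideal of `S` contains such a sequence, and together with the
nilpotent variables `X 0, …, X (t - 1)` the sequence cuts the localized module down to dimension
zero, whence depth and dimension of the localization are both `n - t`
(`isCohenMacaulay_of_isRegularAlong`).
-/

namespace BinomialIdeals

open MvPolynomial RingTheory.Sequence

/-! ### A criterion for the Cohen–Macaulay property over a polynomial ring -/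

section Criterion

variable {K : Type*} [Field K] {σ : Type*}

/-- The quotient by such a prime is a domain that is integral over the field `K`. -/
theorem isMaximal_of_forall_exists_aeval_X_mem (q : Ideal (MvPolynomial σ K)) [q.IsPrime]
    (h : ∀ i, ∃ p : Polynomial K, p ≠ 0 ∧ Polynomial.aeval (X i : MvPolynomial σ K) p ∈ q) :
    q.IsMaximal := by
  have hint : Algebra.IsIntegral K (MvPolynomial σ K ⧸ q) := by
    refine ⟨fun y => ?_⟩
    obtain ⟨f, rfl⟩ := Ideal.Quotient.mk_surjective y
    induction f using MvPolynomial.induction_on with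
    | C a => exact isIntegral_algebraMap (R := K) (A := MvPolynomial σ K ⧸ q) (x := a)
    | add f g hf hg => rw [map_add]; exact hf.add hg
    | mul_X f i hf =>
      rw [map_mul]
      refine hf.mul ?_
      obtain ⟨p, hp0, hp⟩ := h i
      refine IsAlgebraic.isIntegral ⟨p, hp0, ?_⟩
      have := Polynomial.aeval_algHom_apply (Ideal.Quotient.mkₐ K q) (X i : MvPolynomial σ K) p
      simp only [Ideal.Quotient.mkₐ_eq_mk] at this
      rw [this]
      exact Ideal.Quotient.eq_zero_iff_mem.2 hp
  exact Ideal.Quotient.maximal_of_isField _ (isField_of_isIntegral_of_isField' (Field.toIsField K))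

/-- By the Nullstellensatz the residue field is algebraic over `K`. -/
theorem exists_aeval_X_mem_of_isMaximal [Finite σ] (q : Ideal (MvPolynomial σ K)) [q.IsMaximal]
    (i : σ) : ∃ p : Polynomial K, p ≠ 0 ∧ Polynomial.aeval (X i : MvPolynomial σ K) p ∈ q := by
  let _ : Field (MvPolynomial σ K ⧸ q) := Ideal.Quotient.field q
  have hfin : Module.Finite K (MvPolynomial σ K ⧸ q) :=
    finite_of_finite_type_of_isJacobsonRing K (MvPolynomial σ K ⧸ q)
  obtain ⟨p, hp0, hp⟩ := Algebra.IsAlgebraic.isAlgebraic (R := K)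
    (Ideal.Quotient.mk q (X i : MvPolynomial σ K))
  refine ⟨p, hp0, ?_⟩
  have := Polynomial.aeval_algHom_apply (Ideal.Quotient.mkₐ K q) (X i : MvPolynomial σ K) p
  simp only [Ideal.Quotient.mkₐ_eq_mk] at this
  rw [this] at hp
  exact Ideal.Quotient.eq_zero_iff_mem.1 hp

/-- Over a Noetherian local ring the depth is at most the dimension. -/
theorem depth_le_supportDim (R M : Type*) [CommRing R] [IsLocalRing R] [IsNoetherianRing R]
    [AddCommGroup M] [Module R M] [Module.Finite R M] [Nontrivial M] :
    (depth R M : WithBot ℕ∞) ≤ Module.supportDim R M := by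
  have key : ∀ rs : List R, IsRegular M rs → ((rs.length : ℕ∞) : WithBot ℕ∞) ≤
      Module.supportDim R M := by
    intro rs hrs
    rw [← Module.supportDim_add_length_eq_supportDim_of_isRegular rs hrs]
    have hnt : Nontrivial (M ⧸ Ideal.ofList rs • (⊤ : Submodule R M)) :=
      Submodule.Quotient.nontrivial_iff.2 hrs.top_ne_smul.symm
    have hne : Module.supportDim R (M ⧸ Ideal.ofList rs • (⊤ : Submodule R M)) ≠ ⊥ :=
      Module.supportDim_ne_bot_of_nontrivial R _
    obtain ⟨a, ha⟩ := WithBot.ne_bot_iff_exists.1 hne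
    rw [← ha]
    exact_mod_cast (le_add_self : ((rs.length : ℕ) : ℕ∞) ≤ a + rs.length)
  obtain ⟨a, ha⟩ := WithBot.ne_bot_iff_exists.1 (Module.supportDim_ne_bot_of_nontrivial R M)
  rw [← ha] at key ⊢
  refine WithBot.coe_le_coe.2 (iSup₂_le fun rs hrs => ?_)
  exact WithBot.coe_le_coe.1 (key rs hrs.2)

theorem length_le_depth {R M : Type*} [CommRing R] [IsLocalRing R]
    [AddCommGroup M] [Module R M] {rs : List R} (h : IsRegular M rs)
    (hmem : ∀ r ∈ rs, r ∈ IsLocalRing.maximalIdeal R) : (rs.length : ℕ∞) ≤ depth R M :=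
  le_iSup₂_of_le rs ⟨hmem, h⟩ le_rfl

theorem comap_mem_support_of_mem_support_localizedModule {R M : Type*} [CommRing R]
    [AddCommGroup M] [Module R M] [Module.Finite R M] (T : Submonoid R)
    {Q : PrimeSpectrum (Localization T)}
    (hQ : Q ∈ Module.support (Localization T) (LocalizedModule T M)) :
    PrimeSpectrum.comap (algebraMap R (Localization T)) Q ∈ Module.support R M := by
  rw [Module.mem_support_iff_of_finite]
  intro a ha
  have hQ' := Module.annihilator_le_of_mem_support hQ
  refine hQ' (Module.mem_annihilator.2 fun y => ?_)
  induction y using LocalizedModule.induction_on with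
  | h m s =>
    rw [algebraMap_smul, LocalizedModule.smul'_mk, Module.mem_annihilator.1 ha,
      LocalizedModule.zero_mk]

variable {M : Type*} [AddCommGroup M] [Module (MvPolynomial σ K) M]

theorem X_mem_of_mem_support {i : σ} {N : ℕ} (h : ∀ m : M, (X i : MvPolynomial σ K) ^ N • m = 0)
    {q : PrimeSpectrum (MvPolynomial σ K)} (hq : q ∈ Module.support (MvPolynomial σ K) M) :
    (X i : MvPolynomial σ K) ∈ q.asIdeal :=
  q.2.mem_of_pow_mem N
    (Module.annihilator_le_of_mem_support hq (Module.mem_annihilator.2 h))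

/-- The variables outside `l` act nilpotently on `M`, and for each choice of nonzero
univariate polynomials `p i` the sequence of the `p i (X i)`, `i ∈ l`, is weakly `M`-regular.
Finitely generated modules with this property are Cohen–Macaulay of dimension `l.length` (or
zero). The polynomials `p i` other than `X i` are there for the maximal ideals that are not
generated by the variables. -/
structure IsRegularAlong (K : Type*) [Field K] {σ : Type*} (l : List σ) (M : Type*) [AddCommGroup M]
    [Module (MvPolynomial σ K) M] : Prop where
  nilpotent : ∀ i ∉ l, ∃ N : ℕ, ∀ m : M, (X i : MvPolynomial σ K) ^ N • m = 0
  isWeaklyRegular : ∀ p : σ → Polynomial K, (∀ i, p i ≠ 0) →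
    IsWeaklyRegular M (l.map fun i => Polynomial.aeval (X i : MvPolynomial σ K) (p i))

theorem IsRegularAlong.congr {M' : Type*} [AddCommGroup M'] [Module (MvPolynomial σ K) M']
    {l : List σ} (h : IsRegularAlong K l M) (e : M ≃ₗ[MvPolynomial σ K] M') :
    IsRegularAlong K l M' where
  nilpotent i hi := by
    obtain ⟨N, hN⟩ := h.nilpotent i hi
    refine ⟨N, fun m => ?_⟩
    rw [← e.apply_symm_apply m, ← map_smul, hN, map_zero]
  isWeaklyRegular p hp := (e.isWeaklyRegular_congr _).1 (h.isWeaklyRegular p hp)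

variable [Finite σ] [Module.Finite (MvPolynomial σ K) M] {l : List σ}

/-- If `M` is regular along `l`, then its localizations at the maximal ideals of its support have
depth and dimension `l.length`: a maximal ideal contains a nonzero `p i (X i)` for each `i`, and
these elements cut `M` down to dimension zero. -/
theorem depth_eq_and_supportDim_eq_of_isRegularAlong
    (h : IsRegularAlong K l M)
    (𝔪 : PrimeSpectrum (MvPolynomial σ K)) (hmax : 𝔪.asIdeal.IsMaximal)
    (hsupp : 𝔪 ∈ Module.support (MvPolynomial σ K) M) :
    (depth (Localization.AtPrime 𝔪.asIdeal)
        (LocalizedModule 𝔪.asIdeal.primeCompl M) : WithBot ℕ∞) = (l.length : ℕ∞) ∧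
      Module.supportDim (Localization.AtPrime 𝔪.asIdeal)
        (LocalizedModule 𝔪.asIdeal.primeCompl M) = (l.length : ℕ∞) := by
  choose p hp0 hp using fun i => exists_aeval_X_mem_of_isMaximal 𝔪.asIdeal i
  set R' := Localization.AtPrime 𝔪.asIdeal
  set M' := LocalizedModule 𝔪.asIdeal.primeCompl M
  have hnt : Nontrivial M' := hsupp
  have hfin : Module.Finite R' M' :=
    Module.Finite.of_isLocalizedModule 𝔪.asIdeal.primeCompl
      (LocalizedModule.mkLinearMap 𝔪.asIdeal.primeCompl M)
  have hnoeth : IsNoetherianRing R' :=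
    IsLocalization.isNoetherianRing 𝔪.asIdeal.primeCompl R' inferInstance
  set rs := l.map fun i => Polynomial.aeval (X i : MvPolynomial σ K) (p i)
  have hmem : ∀ r ∈ rs, r ∈ 𝔪.asIdeal := by
    intro r hr
    obtain ⟨i, -, rfl⟩ := List.mem_map.1 hr
    exact hp i
  set rs' := rs.map (algebraMap (MvPolynomial σ K) R')
  have hlen : rs'.length = l.length := by simp [rs', rs]
  have hR : IsRegular M' rs' :=
    (h.isWeaklyRegular p hp0).isRegular_of_isLocalizedModule_of_mem R' 𝔪.asIdeal
      (LocalizedModule.mkLinearMap 𝔪.asIdeal.primeCompl M) hmem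
  have hmem' : ∀ r ∈ rs', r ∈ IsLocalRing.maximalIdeal R' := by
    intro r hr
    obtain ⟨s, hs, rfl⟩ := List.mem_map.1 hr
    exact (IsLocalization.AtPrime.to_map_mem_maximal_iff R' 𝔪.asIdeal s).2 (hmem s hs)
  have hdim : Module.supportDim R' M' = (l.length : ℕ∞) := by
    rw [← Module.supportDim_add_length_eq_supportDim_of_isRegular rs' hR, hlen]
    have hnt' : Nontrivial (M' ⧸ Ideal.ofList rs' • (⊤ : Submodule R' M')) :=
      Submodule.Quotient.nontrivial_iff.2 hR.top_ne_smul.symm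
    -- A prime in the support of `M' / rs' M'` contracts to a prime that contains a nonzero polynomial
    -- in each variable, hence to a maximal ideal inside `𝔪`.
    have hss : (Module.support R' (M' ⧸ Ideal.ofList rs' • (⊤ : Submodule R' M'))).Subsingleton := by
      have key : ∀ Q ∈ Module.support R' (M' ⧸ Ideal.ofList rs' • (⊤ : Submodule R' M')),
          PrimeSpectrum.comap (algebraMap (MvPolynomial σ K) R') Q = 𝔪 := by
        intro Q hQ
        have hQM : Q ∈ Module.support R' M' :=
          Module.support_subset_of_surjective (Submodule.mkQ _) (Submodule.mkQ_surjective _) hQ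
        have hq := comap_mem_support_of_mem_support_localizedModule 𝔪.asIdeal.primeCompl hQM
        set q := PrimeSpectrum.comap (algebraMap (MvPolynomial σ K) R') Q
        have hqmax : q.asIdeal.IsMaximal := by
          refine isMaximal_of_forall_exists_aeval_X_mem _ fun i => ?_
          by_cases hi : i ∈ l
          · refine ⟨p i, hp0 i, ?_⟩
            refine Module.annihilator_le_of_mem_support hQ (Module.mem_annihilator.2 fun y => ?_)
            obtain ⟨y, rfl⟩ := Submodule.Quotient.mk_surjective _ y
            rw [← Submodule.Quotient.mk_smul, Submodule.Quotient.mk_eq_zero]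
            refine Submodule.smul_mem_smul (Ideal.subset_span ?_) Submodule.mem_top
            exact List.mem_map.2 ⟨_, List.mem_map.2 ⟨i, hi, rfl⟩, rfl⟩
          · obtain ⟨N, hN⟩ := h.nilpotent i hi
            refine ⟨Polynomial.X, Polynomial.X_ne_zero, ?_⟩
            rw [Polynomial.aeval_X]
            exact X_mem_of_mem_support hN hq
        refine PrimeSpectrum.ext (hqmax.eq_of_le hmax.ne_top fun a ha => ?_)
        by_contra hna
        have hu : IsUnit (algebraMap (MvPolynomial σ K) R' a) :=
          IsLocalization.map_units R' (⟨a, hna⟩ : 𝔪.asIdeal.primeCompl)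
        exact Q.2.ne_top (Ideal.eq_top_of_isUnit_mem _ ha hu)
      intro Q₁ h₁ Q₂ h₂
      exact PrimeSpectrum.localization_comap_injective R' 𝔪.asIdeal.primeCompl
        ((key Q₁ h₁).trans (key Q₂ h₂).symm)
    have h0 : Module.supportDim R' (M' ⧸ Ideal.ofList rs' • (⊤ : Submodule R' M')) = 0 := by
      have : Subsingleton (Module.support R' (M' ⧸ Ideal.ofList rs' • (⊤ : Submodule R' M'))) :=
        hss.coe_sort
      have : Nonempty (Module.support R' (M' ⧸ Ideal.ofList rs' • (⊤ : Submodule R' M'))) :=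
        (Module.nonempty_support_of_nontrivial).to_subtype
      exact Order.krullDim_eq_zero
    rw [h0, zero_add]
    rfl
  refine ⟨le_antisymm (hdim ▸ depth_le_supportDim R' M') ?_, hdim⟩
  rw [← hlen]
  exact WithBot.coe_le_coe.2 (length_le_depth hR hmem')

theorem isCohenMacaulay_of_isRegularAlong
    (h : IsRegularAlong K l M) :
    IsCohenMacaulay (MvPolynomial σ K) M := fun 𝔪 hmax hsupp => by
  obtain ⟨h₁, h₂⟩ := depth_eq_and_supportDim_eq_of_isRegularAlong h 𝔪 hmax hsupp
  exact h₁.trans h₂.symm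

theorem supportDim_eq_length_of_isRegularAlong [Nontrivial M] (hl : l.Nodup)
    (h : IsRegularAlong K l M) :
    Module.supportDim (MvPolynomial σ K) M = (l.length : ℕ∞) := by
  classical
  refine le_antisymm ?_ ?_
  · set I : Ideal (MvPolynomial σ K) := Ideal.span (X '' {i | i ∉ l})
    have hI : ∀ q ∈ Module.support (MvPolynomial σ K) M, q ∈ PrimeSpectrum.zeroLocus (I : Set _) := by
      intro q hq
      rw [PrimeSpectrum.mem_zeroLocus]
      refine Ideal.span_le.2 ?_
      rintro _ ⟨i, hi, rfl⟩
      obtain ⟨N, hN⟩ := h.nilpotent i hi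
      exact X_mem_of_mem_support hN hq
    have h₁ : Module.supportDim (MvPolynomial σ K) M ≤ ringKrullDim (MvPolynomial σ K ⧸ I) := by
      rw [ringKrullDim_quotient]
      exact Order.krullDim_le_of_strictMono (fun a => ⟨a.1, hI a.1 a.2⟩) fun {_ _} h => h
    have h₂ : ringKrullDim (MvPolynomial σ K ⧸ I) ≤ ringKrullDim (MvPolynomial {i // i ∈ l} K) := by
      refine ringKrullDim_le_of_surjective ((Ideal.Quotient.mk I).comp
        (rename (Subtype.val : {i // i ∈ l} → σ)).toRingHom) fun y => ?_
      obtain ⟨f, rfl⟩ := Ideal.Quotient.mk_surjective y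
      induction f using MvPolynomial.induction_on with
      | C a => exact ⟨C a, by simp⟩
      | add f g hf hg =>
        obtain ⟨a, ha⟩ := hf
        obtain ⟨b, hb⟩ := hg
        exact ⟨a + b, by rw [map_add, ha, hb, map_add]⟩
      | mul_X f i hf =>
        obtain ⟨a, ha⟩ := hf
        by_cases hi : i ∈ l
        · exact ⟨a * X ⟨i, hi⟩, by rw [map_mul, ha, map_mul]; simp⟩
        · refine ⟨0, ?_⟩
          rw [map_zero, map_mul, Ideal.Quotient.eq_zero_iff_mem.2
            (Ideal.subset_span ⟨i, hi, rfl⟩ : (X i : MvPolynomial σ K) ∈ I), mul_zero]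
    refine (h₁.trans h₂).trans_eq ?_
    rw [MvPolynomial.ringKrullDim_of_isNoetherianRing, ringKrullDim_eq_zero_of_field, zero_add]
    have : Nat.card {i // i ∈ l} = l.length := by
      rw [Nat.card_eq_fintype_card, Fintype.card_of_subtype l.toFinset (by simp),
        List.toFinset_card_of_nodup hl]
    rw [this]
    rfl
  · obtain ⟨q, hq⟩ := Module.nonempty_support_of_nontrivial (R := MvPolynomial σ K) (M := M)
    obtain ⟨𝔪, hmax, hle⟩ := Ideal.exists_le_maximal q.asIdeal q.2.ne_top
    have hsupp : (⟨𝔪, hmax.isPrime⟩ : PrimeSpectrum (MvPolynomial σ K)) ∈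
        Module.support (MvPolynomial σ K) M := Module.mem_support_mono hle hq
    obtain ⟨-, h₂⟩ := depth_eq_and_supportDim_eq_of_isRegularAlong h _ hmax hsupp
    rw [← h₂]
    refine Order.krullDim_le_of_strictMono (fun Q => ⟨_,
      comap_mem_support_of_mem_support_localizedModule _ Q.2⟩) fun {Q₁ Q₂} hQ => ?_
    refine lt_of_le_of_ne (Ideal.comap_mono (show Q₁.1.asIdeal ≤ Q₂.1.asIdeal from hQ.le))
      fun he => hQ.ne (Subtype.ext ?_)
    exact PrimeSpectrum.localization_comap_injective _ 𝔪.primeCompl (congrArg Subtype.val he)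

end Criterion

/-! ### Ideals extended from a polynomial ring in fewer variables -/

section Extended

variable {K : Type*} [Field K] {σ : Type*} [DecidableEq σ]

/-- The embedding of `K[X]` into `K[X][Y]` that sends `X i` to `Y` and fixes the other
variables. -/
noncomputable def expandVar (i : σ) : MvPolynomial σ K →ₐ[K] Polynomial (MvPolynomial σ K) :=
  aeval fun j => if j = i then Polynomial.X else Polynomial.C (X j)

/-- The ideal `J` is extended from the polynomial ring without the variable `X i`. In terms of
`expandVar`: the coefficients of the elements of `J` with respect to the powers of `X i` lie
in `J`. -/
def IsExtended (i : σ) (J : Ideal (MvPolynomial σ K)) : Prop :=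
  J.map (expandVar i) ≤ J.map (Polynomial.C : MvPolynomial σ K →+* _)

theorem expandVar_aeval_X_self (i : σ) (p : Polynomial K) :
    expandVar i (Polynomial.aeval (X i : MvPolynomial σ K) p) =
      p.map (algebraMap K (MvPolynomial σ K)) := by
  rw [← Polynomial.aeval_algHom_apply, expandVar, aeval_X, if_pos rfl,
    ← Polynomial.aeval_map_algebraMap (MvPolynomial σ K), Polynomial.aeval_X_left_apply]

theorem expandVar_aeval_X_of_ne {i j : σ} (h : j ≠ i) (p : Polynomial K) :
    expandVar i (Polynomial.aeval (X j : MvPolynomial σ K) p) =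
      Polynomial.C (Polynomial.aeval (X j : MvPolynomial σ K) p) := by
  rw [← Polynomial.aeval_algHom_apply, expandVar, aeval_X, if_neg h]
  exact Polynomial.aeval_algHom_apply (Polynomial.CAlgHom (R := K) (A := MvPolynomial σ K)) _ _

theorem expandVar_monomial {i : σ} {a : σ →₀ ℕ} (h : a i = 0) :
    expandVar i (monomial a (1 : K)) = Polynomial.C (monomial a 1) := by
  have hC : ∀ f : MvPolynomial σ K, Polynomial.C f =
      Polynomial.CAlgHom (R := K) (A := MvPolynomial σ K) f := fun _ => rfl
  rw [monomial_eq, map_one, one_mul, hC, Finsupp.prod, map_prod, map_prod]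
  refine Finset.prod_congr rfl fun j hj => ?_
  have hji : j ≠ i := by rintro rfl; exact Finsupp.mem_support_iff.1 hj h
  rw [map_pow, map_pow, expandVar, aeval_X, if_neg hji]
  rfl

/-- Substituting `X i` for `Y` undoes `expandVar i`. -/
theorem eval_expandVar (i : σ) (f : MvPolynomial σ K) :
    Polynomial.eval (X i) (expandVar i f) = f := by
  have : ((Polynomial.aeval (X i : MvPolynomial σ K)).restrictScalars K).comp (expandVar i) =
      AlgHom.id K _ := by
    ext j
    by_cases hj : j = i <;> simp [expandVar, hj]
  simpa [Polynomial.aeval_def] using! DFunLike.congr_fun this f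

variable {i : σ} {I J : Ideal (MvPolynomial σ K)}

theorem isExtended_span {T : Set (MvPolynomial σ K)}
    (h : ∀ f ∈ T, expandVar i f = Polynomial.C f) : IsExtended i (Ideal.span T) := by
  rw [IsExtended, Ideal.map_span, Ideal.span_le]
  rintro _ ⟨f, hf, rfl⟩
  exact (h f hf).symm ▸ Ideal.mem_map_of_mem _ (Ideal.subset_span hf)

theorem IsExtended.sup (hI : IsExtended i I) (hJ : IsExtended i J) : IsExtended i (I ⊔ J) := by
  rw [IsExtended, Ideal.map_sup, Ideal.map_sup]
  exact sup_le_sup hI hJ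

theorem IsExtended.mul (hI : IsExtended i I) (hJ : IsExtended i J) : IsExtended i (I * J) := by
  rw [IsExtended, Ideal.map_mul, Ideal.map_mul]
  exact Ideal.mul_mono hI hJ

theorem isExtended_top : IsExtended i (⊤ : Ideal (MvPolynomial σ K)) := by
  rw [IsExtended, Ideal.map_top, Ideal.map_top]

/-- A nonzero polynomial in a variable that the generators of `J` do not involve is a
nonzerodivisor modulo `J`. -/
theorem IsExtended.mem_of_aeval_mul_mem (hJ : IsExtended i J) {p : Polynomial K} (hp : p ≠ 0)
    {f : MvPolynomial σ K} (hf : Polynomial.aeval (X i) p * f ∈ J) : f ∈ J := by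
  have hm : expandVar i (Polynomial.aeval (X i) (p * Polynomial.C p.leadingCoeff⁻¹) * f) ∈
      J.map (Polynomial.C : MvPolynomial σ K →+* _) := by
    refine hJ (Ideal.mem_map_of_mem _ ?_)
    rw [map_mul, mul_assoc, mul_left_comm]
    exact J.mul_mem_left _ hf
  have hmonic := (Polynomial.monic_mul_leadingCoeff_inv hp).map
    (algebraMap K (MvPolynomial σ K))
  rw [map_mul, expandVar_aeval_X_self] at hm
  set q := (p * Polynomial.C p.leadingCoeff⁻¹).map (algebraMap K (MvPolynomial σ K))
  have hker : ∀ g : Polynomial (MvPolynomial σ K),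
      g ∈ J.map (Polynomial.C : MvPolynomial σ K →+* _) ↔ g.map (Ideal.Quotient.mk J) = 0 := by
    intro g
    rw [Ideal.mem_map_C_iff, Polynomial.ext_iff]
    simp [Ideal.Quotient.eq_zero_iff_mem]
  -- Over `K[X] / J` a monic polynomial is a nonzerodivisor.
  rw [hker, Polynomial.map_mul, (hmonic.map _).mul_right_eq_zero_iff, ← hker] at hm
  have := Ideal.mem_map_of_mem (Polynomial.evalRingHom (X i)) hm
  rw [Ideal.map_map] at this
  have hid : (Polynomial.evalRingHom (X i)).comp
      (Polynomial.C : MvPolynomial σ K →+* _) = RingHom.id _ := by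
    ext <;> simp
  rw [hid, Ideal.map_id] at this
  simpa [eval_expandVar] using this

theorem isWeaklyRegular_quotient_cons_iff {R M : Type*} [CommRing R] [AddCommGroup M] [Module R M]
    (N : Submodule R M) (r : R) (rs : List R) :
    IsWeaklyRegular (M ⧸ N) (r :: rs) ↔
      (∀ x, r • x ∈ N → x ∈ N) ∧
        IsWeaklyRegular (M ⧸ (N ⊔ Ideal.span {r} • (⊤ : Submodule R M))) rs := by
  rw [isWeaklyRegular_cons_iff]
  refine and_congr ?_ (LinearEquiv.isWeaklyRegular_congr ?_ rs)
  · rw [isSMulRegular_iff_right_eq_zero_of_smul]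
    refine ⟨fun h x hx => ?_, fun h x hx => ?_⟩
    · rw [← Submodule.Quotient.mk_eq_zero]
      refine h _ ?_
      rwa [← Submodule.Quotient.mk_smul, Submodule.Quotient.mk_eq_zero]
    · obtain ⟨x, rfl⟩ := Submodule.Quotient.mk_surjective _ x
      rw [← Submodule.Quotient.mk_smul, Submodule.Quotient.mk_eq_zero] at hx
      exact (Submodule.Quotient.mk_eq_zero _).2 (h x hx)
  · refine (Submodule.quotEquivOfEq _ _ ?_).trans (Submodule.quotientQuotientEquivQuotientSup N _)
    rw [Submodule.map_smul'', Submodule.map_top, Submodule.range_mkQ,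
      Submodule.ideal_span_singleton_smul]

theorem submoduleOf_sup_span_singleton_mul {R : Type*} [CommRing R] {I J : Ideal R} (h : J ≤ I)
    (r : R) : (J ⊔ Ideal.span {r} * I).submoduleOf I =
      J.submoduleOf I ⊔ Ideal.span {r} • (⊤ : Submodule R I) := by
  rw [Submodule.submoduleOf_sup_of_le h Ideal.mul_le_right]
  congr 1
  refine Submodule.map_injective_of_injective I.subtype_injective ?_
  rw [Submodule.map_smul'', Submodule.map_top, Submodule.range_subtype, Submodule.submoduleOf,
    Submodule.map_comap_subtype, smul_eq_mul, inf_eq_right]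
  exact Ideal.mul_le_right

/-- Let `J ≤ I` be ideals that have generators without the variables `X j`, `j ∈ l`, and let
`p i (X i)` be a nonzerodivisor modulo `J`. Then the `p j (X j)`, `j ∈ i :: l`, form a weakly
regular sequence on `I / J`: adding `p i (X i) * I` to `J` does not affect the other variables, so
that each further element is a nonzerodivisor modulo the ideal in question. -/
theorem isWeaklyRegular_subquotient (p : σ → Polynomial K) (hp : ∀ j, p j ≠ 0) {l : List σ}
    (hl : (i :: l).Nodup) (hJI : J ≤ I) (hI : ∀ j ∈ l, IsExtended j I)
    (hJ : ∀ j ∈ l, IsExtended j J)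
    (hi : ∀ f, Polynomial.aeval (X i) (p i) * f ∈ J → f ∈ J) :
    IsWeaklyRegular (Subquotient I J)
      ((i :: l).map fun j => Polynomial.aeval (X j : MvPolynomial σ K) (p j)) := by
  induction l generalizing i J with
  | nil =>
    rw [List.map_cons, isWeaklyRegular_quotient_cons_iff]
    exact ⟨fun x hx => hi _ hx, IsWeaklyRegular.nil _ _⟩
  | cons k l ih =>
    rw [List.map_cons, isWeaklyRegular_quotient_cons_iff,
      ← submoduleOf_sup_span_singleton_mul hJI]
    rw [List.nodup_cons] at hl
    have hex : ∀ j ∈ k :: l, IsExtended j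
        (J ⊔ Ideal.span {Polynomial.aeval (X i : MvPolynomial σ K) (p i)} * I) := fun j hj =>
      (hJ j hj).sup <| .mul (isExtended_span fun f hf => by
        rw [Set.mem_singleton_iff.1 hf]
        exact expandVar_aeval_X_of_ne (by rintro rfl; exact hl.1 hj) _) (hI j hj)
    refine ⟨fun x hx => hi _ hx, ih hl.2 (sup_le hJI Ideal.mul_le_right)
      (fun j hj => hI j (List.mem_cons_of_mem _ hj))
      (fun j hj => hex j (List.mem_cons_of_mem _ hj)) fun f hf => ?_⟩
    exact (hex k List.mem_cons_self).mem_of_aeval_mul_mem (hp k) hf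

end Extended

/-! ### Filtrations of graded quotients -/

/-- A chain whose steps satisfy `Q`, and whose proper steps have strictly increasing values
`δ`, becomes a strict chain after the removal of repetitions. -/
theorem exists_strict_chain {α β : Type*} [PartialOrder α] [Preorder β] (P : α → Prop)
    (Q : α → α → Prop) (δ : α → α → β) {D : ℕ → β} (hD : StrictMono D) (G : ℕ → α) (r : ℕ)
    (hG : ∀ i < r, G i ≤ G (i + 1)) (hP : ∀ i ≤ r, P (G i)) (hQ : ∀ i < r, Q (G (i + 1)) (G i))
    (hδ : ∀ i < r, G i ≠ G (i + 1) → δ (G (i + 1)) (G i) = D i) :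
    ∃ (s : ℕ) (N : ℕ → α), N 0 = G 0 ∧ N s = G r ∧ (∀ i < s, N i < N (i + 1)) ∧
      (∀ i ≤ s, P (N i)) ∧ (∀ i < s, Q (N (i + 1)) (N i)) ∧
      (∀ i, i + 1 < s → δ (N (i + 1)) (N i) < δ (N (i + 2)) (N (i + 1))) := by
  -- The last value of `δ` has to be bounded in the induction, so that a step can be appended.
  suffices h : ∃ (s : ℕ) (N : ℕ → α), N 0 = G 0 ∧ N s = G r ∧ (∀ i < s, N i < N (i + 1)) ∧
      (∀ i ≤ s, P (N i)) ∧ (∀ i < s, Q (N (i + 1)) (N i)) ∧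
      (∀ i, i + 1 < s → δ (N (i + 1)) (N i) < δ (N (i + 2)) (N (i + 1))) ∧
      ∀ i < s, δ (N (i + 1)) (N i) < D r by
    obtain ⟨s, N, h₁, h₂, h₃, h₄, h₅, h₆, -⟩ := h
    exact ⟨s, N, h₁, h₂, h₃, h₄, h₅, h₆⟩
  induction r with
  | zero => exact ⟨0, fun _ => G 0, rfl, rfl, by simp, by simpa using hP, by simp, by simp, by simp⟩
  | succ r ih =>
    obtain ⟨s, N, h₁, h₂, h₃, h₄, h₅, h₆, h₇⟩ := ih (fun i hi => hG i (by omega))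
      (fun i hi => hP i (by omega)) (fun i hi => hQ i (by omega)) (fun i hi => hδ i (by omega))
    have hDr : D r < D (r + 1) := hD (Nat.lt_succ_self r)
    by_cases he : G r = G (r + 1)
    · exact ⟨s, N, h₁, h₂.trans he, h₃, h₄, h₅, h₆, fun i hi => (h₇ i hi).trans hDr⟩
    set N' : ℕ → α := fun i => if i ≤ s then N i else G (r + 1) with hN'
    have hle : ∀ i ≤ s, N' i = N i := fun i hi => if_pos hi
    have hs1 : N' (s + 1) = G (r + 1) := if_neg (by omega)
    have hs : N' s = G r := (hle s le_rfl).trans h₂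
    have hδs : δ (N' (s + 1)) (N' s) = D r := by rw [hs1, hs, hδ r (by omega) he]
    refine ⟨s + 1, N', (hle 0 (Nat.zero_le _)).trans h₁, hs1, fun i hi => ?_, fun i hi => ?_,
      fun i hi => ?_, fun i hi => ?_, fun i hi => ?_⟩
    · rcases Nat.lt_succ_iff_lt_or_eq.1 hi with hi | rfl
      · rw [hle i hi.le, hle (i + 1) hi]; exact h₃ i hi
      · rw [hs1, hs]; exact lt_of_le_of_ne (hG r (by omega)) he
    · rcases Nat.le_succ_iff.1 hi with hi | rfl
      · rw [hle i hi]; exact h₄ i hi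
      · rw [hs1]; exact hP _ le_rfl
    · rcases Nat.lt_succ_iff_lt_or_eq.1 hi with hi | rfl
      · rw [hle i hi.le, hle (i + 1) hi]; exact h₅ i hi
      · rw [hs1, hs]; exact hQ r (by omega)
    · rcases Nat.lt_succ_iff_lt_or_eq.1 hi with hi | rfl
      · rw [hle i (by omega), hle (i + 1) (by omega), hle (i + 2) (by omega)]; exact h₆ i hi
      · rw [hδs, hle i (by omega), hle (i + 1) le_rfl]; exact h₇ i (by omega)
    · rcases Nat.lt_succ_iff_lt_or_eq.1 hi with hi | rfl
      · rw [hle i hi.le, hle (i + 1) hi]; exact (h₇ i hi).trans hDr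
      · rw [hδs]; exact hDr

section Subquotient

variable {R M : Type*} [CommRing R] [AddCommGroup M] [Module R M]

/-- `(P / I) / (N / I) ≃ P / N` for submodules `I ≤ N` and `P`. -/
noncomputable def subquotientMapMkQEquiv (I P N : Submodule R M) (hIN : I ≤ N) :
    Subquotient P N ≃ₗ[R] Subquotient (P.map I.mkQ) (N.map I.mkQ) := by
  refine (Submodule.quotEquivOfEq _ _ ?_).trans (LinearMap.quotKerEquivOfSurjective
    ((Submodule.mkQ _).comp ((I.mkQ.restrict (p := P) (q := P.map I.mkQ)
      fun x hx => Submodule.mem_map_of_mem hx))) ?_)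
  · ext ⟨x, hx⟩
    rw [LinearMap.mem_ker, LinearMap.comp_apply, Submodule.mkQ_apply, Submodule.Quotient.mk_eq_zero]
    change x ∈ N ↔ I.mkQ x ∈ N.map I.mkQ
    rw [← Submodule.mem_comap, Submodule.comap_map_mkQ, sup_eq_right.2 hIN]
  · refine (Submodule.mkQ_surjective _).comp ?_
    rintro ⟨_, x, hx, rfl⟩
    exact ⟨⟨x, hx⟩, rfl⟩

theorem subsingleton_subquotient_iff {P N : Submodule R M} :
    Subsingleton (Subquotient P N) ↔ P ≤ N := by
  rw [Submodule.Quotient.subsingleton_iff, Submodule.submoduleOf_eq_top]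

end Subquotient

section Graded

variable {K : Type*} [Field K] {n : ℕ} {I : Ideal (MvPolynomial (Fin n) K)}

theorem homogeneousComponent_mem_of_isHomogeneous
    (hI : I.IsHomogeneous (homogeneousSubmodule (Fin n) K)) {f : MvPolynomial (Fin n) K}
    (hf : f ∈ I) (i : ℕ) : homogeneousComponent i f ∈ I := by
  have := hI i hf
  rwa [← decomposition.decompose'_apply]

theorem isInternal_quotientGrading (hI : I.IsHomogeneous (homogeneousSubmodule (Fin n) K)) :
    DirectSum.IsInternal (quotientGrading I) := by
  classical
  rw [DirectSum.isInternal_submodule_iff_iSupIndep_and_iSup_eq_top]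
  constructor
  · rw [iSupIndep_iff_finsetSum_eq_zero_imp_eq_zero]
    intro s v hv hsum i hi
    choose! g hg hgv using hv
    have hmem : ∑ j ∈ s, g j ∈ I := by
      rw [← Ideal.Quotient.eq_zero_iff_mem, map_sum, ← hsum]
      exact Finset.sum_congr rfl hgv
    have hcomp := homogeneousComponent_mem_of_isHomogeneous hI hmem i
    rw [map_sum, Finset.sum_eq_single_of_mem i hi fun j hj hji => ?_,
      homogeneousComponent_of_mem (hg i hi), if_pos rfl] at hcomp
    · rw [← hgv i hi]
      exact Ideal.Quotient.eq_zero_iff_mem.2 hcomp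
    · rw [homogeneousComponent_of_mem (hg j hj), if_neg hji.symm]
  · rw [eq_top_iff]
    rintro x -
    obtain ⟨f, rfl⟩ := Ideal.Quotient.mk_surjective x
    rw [← sum_homogeneousComponent f, map_sum]
    refine Submodule.sum_mem _ fun i _ => Submodule.mem_iSup_of_mem i ?_
    exact Submodule.mem_map_of_mem (homogeneousComponent_isHomogeneous i f)

theorem isGradedSubmodule_map_mkQ {J : Ideal (MvPolynomial (Fin n) K)}
    (hJ : J.IsHomogeneous (homogeneousSubmodule (Fin n) K)) :
    IsGradedSubmodule (quotientGrading I) (Submodule.map I.mkQ J) := by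
  refine le_antisymm (Submodule.span_le.2 fun x hx => hx.1) ?_
  rintro _ ⟨f, hf, rfl⟩
  rw [← sum_homogeneousComponent f, map_sum]
  refine Submodule.sum_mem _ fun i _ => Submodule.subset_span ⟨Submodule.mem_map_of_mem ?_, i, ?_⟩
  · exact homogeneousComponent_mem_of_isHomogeneous hJ hf i
  · exact Submodule.mem_map_of_mem (homogeneousComponent_isHomogeneous i f)

/-- A chain of homogeneous ideals from `I` to the unit ideal whose subquotients are regular along
lists of variables of strictly increasing lengths. -/
theorem isSequentiallyCohenMacaulay_quotientGrading
    (G : ℕ → Ideal (MvPolynomial (Fin n) K)) (r : ℕ) (h0 : G 0 = I) (hr : G r = ⊤)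
    (hG : Monotone G)
    (hhom : ∀ i ≤ r, (G i).IsHomogeneous (homogeneousSubmodule (Fin n) K))
    (l : ℕ → List (Fin n)) (hl : ∀ i < r, (l i).Nodup) {D : ℕ → ℕ} (hD : StrictMono D)
    (hlD : ∀ i < r, (l i).length = D i)
    (hreg : ∀ i < r, IsRegularAlong K (l i) (Subquotient (G (i + 1)) (G i))) :
    IsSequentiallyCohenMacaulay (homogeneousSubmodule (Fin n) K) (quotientGrading I) where
  finite := inferInstance
  isInternal := isInternal_quotientGrading (h0 ▸ hhom 0 (Nat.zero_le _))
  smul_mem := by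
    rintro i j a _ ha ⟨f, hf, rfl⟩
    exact ⟨a * f, SetLike.mul_mem_graded ha hf, rfl⟩
  exists_filtration := by
    have hIG : ∀ i, I ≤ G i := fun i => h0 ▸ hG (Nat.zero_le i)
    have hreg' : ∀ i < r, IsRegularAlong K (l i)
        (Subquotient (Submodule.map I.mkQ (G (i + 1))) (Submodule.map I.mkQ (G i))) := fun i hi =>
      (hreg i hi).congr (subquotientMapMkQEquiv I _ _ (hIG i))
    obtain ⟨s, N, h₁, h₂, h₃, h₄, h₅, h₆⟩ := exists_strict_chain
      (IsGradedSubmodule (quotientGrading I))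
      (fun P N => IsCohenMacaulay (MvPolynomial (Fin n) K) (Subquotient P N))
      (fun P N => Module.supportDim (MvPolynomial (Fin n) K) (Subquotient P N))
      (D := fun i => (((D i : ℕ) : ℕ∞) : WithBot ℕ∞)) (fun i j hij =>
        WithBot.coe_lt_coe.2 (Nat.cast_lt.2 (hD hij)))
      (fun i => Submodule.map I.mkQ (G i)) r (fun i _ => Submodule.map_mono (hG (Nat.le_succ i)))
      (fun i hi => isGradedSubmodule_map_mkQ (hhom i hi))
      (fun i hi => isCohenMacaulay_of_isRegularAlong (hreg' i hi))
      (fun i hi hne => by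
        have : Nontrivial (Subquotient (Submodule.map I.mkQ (G (i + 1))) (Submodule.map I.mkQ (G i))) := by
          rw [← not_subsingleton_iff_nontrivial, subsingleton_subquotient_iff]
          exact fun h => hne (le_antisymm (Submodule.map_mono (hG (Nat.le_succ i))) h)
        rw [supportDim_eq_length_of_isRegularAlong (hl i hi) (hreg' i hi), hlD i hi])
    refine ⟨s, N, h₁.trans ?_, h₂.trans ?_, h₃, h₄, h₅, h₆⟩
    · rw [h0, Submodule.mkQ_map_self]
    · rw [hr, Submodule.map_top, Submodule.range_mkQ]

end Graded

/-! ### Normal forms modulo monomials and binomials -/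

section NormalForm

variable {n : ℕ}

/-- The vector `w + ρ`, with negative entries replaced by zero. -/
noncomputable def shift (ρ : Fin n → ℤ) (w : Fin n →₀ ℕ) : Fin n →₀ ℕ :=
  Finsupp.equivFunOnFinite.symm fun i => ((w i : ℤ) + ρ i).toNat

theorem IsTranslate.shift_eq {ρ : Fin n → ℤ} {w b : Fin n →₀ ℕ} (h : IsTranslate ρ w b) :
    shift ρ w = b := by
  ext i
  simp [shift, ← h i]

theorem isTranslate_shift {ρ : Fin n → ℤ} {w : Fin n →₀ ℕ} (h : ∀ i, 0 ≤ (w i : ℤ) + ρ i) :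
    IsTranslate ρ w (shift ρ w) := fun i => by
  simp [shift, h i]

theorem IsTranslate.add_right {ρ : Fin n → ℤ} {w b : Fin n →₀ ℕ} (h : IsTranslate ρ w b)
    (u : Fin n →₀ ℕ) : IsTranslate ρ (w + u) (b + u) := fun i => by
  have := h i
  simp only [Finsupp.add_apply]
  push_cast
  linarith

theorem IsTranslate.exists_of_le {ρ : Fin n → ℤ} {c b w : Fin n →₀ ℕ} (h : IsTranslate ρ c b)
    (hcw : c ≤ w) : ∃ u, w = u + c ∧ IsTranslate ρ w (u + b) := by
  obtain ⟨u, rfl⟩ := exists_add_of_le hcw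
  exact ⟨u, add_comm _ _, by simpa [add_comm] using h.add_right u⟩

theorem IsTranslate.unique_right {ρ : Fin n → ℤ} {w b b' : Fin n →₀ ℕ} (h : IsTranslate ρ w b)
    (h' : IsTranslate ρ w b') : b = b' := h.shift_eq.symm.trans h'.shift_eq

theorem IsTranslate.unique_left {ρ : Fin n → ℤ} {w w' b : Fin n →₀ ℕ} (h : IsTranslate ρ w b)
    (h' : IsTranslate ρ w' b) : w = w' := by
  ext i
  have h₁ := h i
  have h₂ := h' i
  omega

open Classical in
/-- The normal form of the monomial with exponent vector `w` modulo the monomials with exponents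
in `A` and the binomials `X ^ c - X ^ (c + ρ)`, `c ∈ C`: it is zero if some `X ^ a` divides
`X ^ w`; otherwise `w` is replaced by `w + ρ` as long as some `X ^ c` divides `X ^ w`. The clause
on the total degree in the variables other than `X k` makes the recursion well-founded. -/
noncomputable def normalForm (K : Type*) [Field K] (A C : Set (Fin n →₀ ℕ)) (ρ : Fin n → ℤ)
    (k : Fin n) (w : Fin n →₀ ℕ) : MvPolynomial (Fin n) K :=
  if ∃ a ∈ A, a ≤ w then 0
  else if _h : (∃ c ∈ C, c ≤ w) ∧ ((shift ρ w).erase k).degree < (w.erase k).degree then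
    normalForm K A C ρ k (shift ρ w)
  else monomial w 1
termination_by (w.erase k).degree
decreasing_by exact _h.2

/-- Conditions on `(A, C, ρ)` under which `normalForm` computes in the quotient by
`binomialIdeal K A C ρ` and is compatible with multiplication by `X k`: the vectors in `A` and `C`
do not involve the position `k`, where `ρ` is positive, and an overlap of a monomial generator
with the leading term of a binomial one reduces to zero. -/
structure IsConfluent (A C : Set (Fin n →₀ ℕ)) (ρ : Fin n → ℤ) (k : Fin n) : Prop where
  left_apply : ∀ a ∈ A, a k = 0
  right_apply : ∀ c ∈ C, c k = 0
  nonneg : ∀ c ∈ C, ∀ i, 0 ≤ (c i : ℤ) + ρ i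
  pos : ∀ c ∈ C, 0 < ρ k
  sum_eq_zero : ∀ c ∈ C, ∑ i, ρ i = 0
  overlap : ∀ c ∈ C, ∀ a ∈ A, ∀ w w', c ≤ w → a ≤ w → IsTranslate ρ w w' → ∃ a' ∈ A, a' ≤ w'

/-- Adding `ρ` moves weight from the other positions to `k`; this is why the recursion that defines
`normalForm` stops. -/
theorem degree_erase_lt_of_isTranslate {ρ : Fin n → ℤ} {k : Fin n} (hpos : 0 < ρ k)
    (hsum : ∑ i, ρ i = 0) {w w' : Fin n →₀ ℕ} (h : IsTranslate ρ w w') :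
    (w'.erase k).degree < (w.erase k).degree := by
  have key : ∀ v : Fin n →₀ ℕ, (v.erase k).degree + v k = ∑ i, v i := fun v => by
    rw [← Finsupp.degree_eq_sum, ← Finsupp.degree_single k (v k), ← map_add,
      Finsupp.erase_add_single]
  have h₁ := key w
  have h₂ := key w'
  have h₃ : (∑ i, (w' i : ℤ)) = ∑ i, (w i : ℤ) := by
    rw [Finset.sum_congr rfl fun i _ => h i, Finset.sum_add_distrib, hsum, add_zero]
  have h₄ := h k
  have h₅ : ∑ i, w' i = ∑ i, w i := by exact_mod_cast h₃
  omega

theorem le_add_single_iff {k : Fin n} {a w : Fin n →₀ ℕ} (h : a k = 0) :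
    a ≤ w + Finsupp.single k 1 ↔ a ≤ w := by
  refine ⟨fun hle i => ?_, fun hle => hle.trans le_self_add⟩
  have := hle i
  by_cases hi : i = k
  · subst hi; omega
  · simpa [Finsupp.single_apply, Ne.symm hi] using this

variable {K : Type*} [Field K] {A C : Set (Fin n →₀ ℕ)} {ρ : Fin n → ℤ} {k : Fin n}

theorem normalForm_of_exists_left {w : Fin n →₀ ℕ} (h : ∃ a ∈ A, a ≤ w) :
    normalForm K A C ρ k w = 0 := by
  rw [normalForm, if_pos h]

/-- Both sides of a rewriting step have the same normal form. If the left-hand side is also divisible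
by some `X ^ a`, this is the overlap condition. -/
theorem IsConfluent.normalForm_eq (H : IsConfluent A C ρ k) {c w w' : Fin n →₀ ℕ} (hc : c ∈ C)
    (hcw : c ≤ w) (h : IsTranslate ρ w w') :
    normalForm K A C ρ k w = normalForm K A C ρ k w' := by
  by_cases hα : ∃ a ∈ A, a ≤ w
  · obtain ⟨a, ha, haw⟩ := hα
    rw [normalForm_of_exists_left ⟨a, ha, haw⟩,
      normalForm_of_exists_left (H.overlap c hc a ha w w' hcw haw h)]
  · conv_lhs => rw [normalForm]
    have hlt := degree_erase_lt_of_isTranslate (H.pos c hc) (H.sum_eq_zero c hc) h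
    rw [← h.shift_eq] at hlt
    rw [if_neg hα, dif_pos ⟨⟨c, hc, hcw⟩, hlt⟩, h.shift_eq]

theorem normalForm_of_not {w : Fin n →₀ ℕ} (hα : ¬ ∃ a ∈ A, a ≤ w) (hγ : ¬ ∃ c ∈ C, c ≤ w) :
    normalForm K A C ρ k w = monomial w 1 := by
  rw [normalForm, if_neg hα, dif_neg fun h => hγ h.1]

/-- Case distinction and induction along the recursion that defines `normalForm`. -/
theorem IsConfluent.induction (H : IsConfluent A C ρ k) {P : (Fin n →₀ ℕ) → Prop}
    (left : ∀ w, (∃ a ∈ A, a ≤ w) → P w)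
    (right : ∀ w w' c u b, (¬ ∃ a ∈ A, a ≤ w) → c ∈ C → IsTranslate ρ c b → w = u + c →
      w' = u + b → P w' → P w)
    (std : ∀ w, (¬ ∃ a ∈ A, a ≤ w) → (¬ ∃ c ∈ C, c ≤ w) → P w) (w : Fin n →₀ ℕ) : P w := by
  induction hN : (w.erase k).degree using Nat.strong_induction_on generalizing w with
  | _ N ih =>
    by_cases hα : ∃ a ∈ A, a ≤ w
    · exact left w hα
    by_cases hγ : ∃ c ∈ C, c ≤ w
    · obtain ⟨c, hc, hcw⟩ := hγ
      have hb := isTranslate_shift (H.nonneg c hc)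
      obtain ⟨u, hu, hub⟩ := hb.exists_of_le hcw
      refine right w _ c u _ hα hc hb hu rfl (ih _ ?_ _ rfl)
      rw [← hN]
      exact degree_erase_lt_of_isTranslate (H.pos c hc) (H.sum_eq_zero c hc) hub
    · exact std w hα hγ

/-- The divisibility conditions in `normalForm` do not depend on the exponent of `X k`. -/
theorem IsConfluent.normalForm_add_single (H : IsConfluent A C ρ k) (w : Fin n →₀ ℕ) :
    normalForm K A C ρ k (w + Finsupp.single k 1) = X k * normalForm K A C ρ k w := by
  induction w using H.induction with
  | left w h =>
    obtain ⟨a, ha, haw⟩ := h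
    rw [normalForm_of_exists_left ⟨a, ha, haw⟩, mul_zero,
      normalForm_of_exists_left ⟨a, ha, haw.trans le_self_add⟩]
  | right w w' c u b hα hc hb hw hw' ih =>
    have htr : IsTranslate ρ w w' := by
      rw [hw, hw', add_comm u, add_comm u]; exact hb.add_right u
    have hcw : c ≤ w := hw ▸ le_add_self
    rw [H.normalForm_eq hc hcw htr, ← ih]
    exact H.normalForm_eq hc (hcw.trans le_self_add) (htr.add_right _)
  | std w hα hγ =>
    rw [normalForm_of_not hα hγ, normalForm_of_not, add_comm w, monomial_single_add, pow_one]
    · rintro ⟨a, ha, haw⟩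
      exact hα ⟨a, ha, (le_add_single_iff (H.left_apply a ha)).1 haw⟩
    · rintro ⟨c, hc, hcw⟩
      exact hγ ⟨c, hc, (le_add_single_iff (H.right_apply c hc)).1 hcw⟩

theorem monomial_mem_binomialIdeal {a w : Fin n →₀ ℕ} (ha : a ∈ A) (haw : a ≤ w) :
    monomial w (1 : K) ∈ binomialIdeal K A C ρ := by
  obtain ⟨u, rfl⟩ := exists_add_of_le haw
  have : monomial (a + u) (1 : K) = monomial u 1 * monomial a 1 := by
    rw [monomial_mul, one_mul, add_comm]
  rw [this]
  exact Ideal.mul_mem_left _ _ (Ideal.subset_span (Or.inl ⟨a, ha, rfl⟩))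

theorem binomial_mem_binomialIdeal {c b w w' : Fin n →₀ ℕ} (hc : c ∈ C) (hb : IsTranslate ρ c b)
    (u : Fin n →₀ ℕ) (hw : w = u + c) (hw' : w' = u + b) :
    monomial w (1 : K) - monomial w' 1 ∈ binomialIdeal K A C ρ := by
  have : monomial w (1 : K) - monomial w' 1 = monomial u 1 * (monomial c 1 - monomial b 1) := by
    rw [mul_sub, monomial_mul, monomial_mul, one_mul, hw, hw']
  rw [this]
  exact Ideal.mul_mem_left _ _ (Ideal.subset_span (Or.inr ⟨c, hc, b, hb, rfl⟩))

theorem IsConfluent.monomial_sub_normalForm_mem (H : IsConfluent A C ρ k) (w : Fin n →₀ ℕ) :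
    monomial w (1 : K) - normalForm K A C ρ k w ∈ binomialIdeal K A C ρ := by
  induction w using H.induction with
  | left w h =>
    obtain ⟨a, ha, haw⟩ := h
    rw [normalForm_of_exists_left ⟨a, ha, haw⟩, sub_zero]
    exact monomial_mem_binomialIdeal ha haw
  | right w w' c u b hα hc hb hw hw' ih =>
    have htr : IsTranslate ρ w w' := by
      rw [hw, hw', add_comm u, add_comm u]; exact hb.add_right u
    rw [H.normalForm_eq hc (hw ▸ le_add_self) htr]
    simpa using add_mem (binomial_mem_binomialIdeal hc hb u hw hw') ih
  | std w hα hγ =>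
    rw [normalForm_of_not hα hγ, sub_self]
    exact zero_mem _

/-- The linear extension of `normalForm`. -/
noncomputable def normalFormLin (K : Type*) [Field K] (A C : Set (Fin n →₀ ℕ)) (ρ : Fin n → ℤ)
    (k : Fin n) : MvPolynomial (Fin n) K →ₗ[K] MvPolynomial (Fin n) K :=
  (basisMonomials (Fin n) K).constr K (normalForm K A C ρ k)

theorem normalFormLin_monomial (w : Fin n →₀ ℕ) :
    normalFormLin K A C ρ k (monomial w 1) = normalForm K A C ρ k w := by
  have := (basisMonomials (Fin n) K).constr_basis K (normalForm K A C ρ k) w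
  rwa [coe_basisMonomials] at this

theorem IsConfluent.normalFormLin_X_mul (H : IsConfluent A C ρ k) (f : MvPolynomial (Fin n) K) :
    normalFormLin K A C ρ k (X k * f) = X k * normalFormLin K A C ρ k f := by
  have : normalFormLin K A C ρ k ∘ₗ LinearMap.mulLeft K (X k) =
      LinearMap.mulLeft K (X k) ∘ₗ normalFormLin K A C ρ k := by
    refine (basisMonomials (Fin n) K).ext fun w => ?_
    simp only [coe_basisMonomials, LinearMap.comp_apply, LinearMap.mulLeft_apply,
      normalFormLin_monomial]
    rw [← H.normalForm_add_single, ← normalFormLin_monomial, add_comm w, monomial_single_add,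
      pow_one]
  exact LinearMap.congr_fun this f

theorem IsConfluent.normalFormLin_aeval_mul (H : IsConfluent A C ρ k) (p : Polynomial K)
    (f : MvPolynomial (Fin n) K) :
    normalFormLin K A C ρ k (Polynomial.aeval (X k) p * f) =
      Polynomial.aeval (X k) p * normalFormLin K A C ρ k f := by
  induction p using Polynomial.induction_on' with
  | add p q hp hq => rw [map_add, add_mul, add_mul, map_add, hp, hq]
  | monomial e a =>
    rw [Polynomial.aeval_monomial, mul_assoc, mul_assoc, ← Algebra.smul_def, ← Algebra.smul_def,
      map_smul]
    congr 1
    induction e with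
    | zero => simp
    | succ e ih => rw [pow_succ', mul_assoc, H.normalFormLin_X_mul, ih, mul_assoc]

theorem IsConfluent.sub_normalFormLin_mem (H : IsConfluent A C ρ k)
    (f : MvPolynomial (Fin n) K) : f - normalFormLin K A C ρ k f ∈ binomialIdeal K A C ρ := by
  induction f using MvPolynomial.induction_on' with
  | monomial w a =>
    have : monomial w a = a • monomial w (1 : K) := by rw [smul_monomial, smul_eq_mul, mul_one]
    rw [this, map_smul, normalFormLin_monomial, ← smul_sub]
    exact Submodule.smul_of_tower_mem _ a (H.monomial_sub_normalForm_mem w)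
  | add f g hf hg => rw [map_add, add_sub_add_comm]; exact add_mem hf hg

theorem IsConfluent.normalFormLin_eq_zero (H : IsConfluent A C ρ k)
    {f : MvPolynomial (Fin n) K} (hf : f ∈ binomialIdeal K A C ρ) :
    normalFormLin K A C ρ k f = 0 := by
  suffices h : ∀ g, normalFormLin K A C ρ k (g * f) = 0 by simpa using h 1
  have hmon : ∀ f : MvPolynomial (Fin n) K,
      (∀ u, normalFormLin K A C ρ k (monomial u 1 * f) = 0) →
        ∀ g, normalFormLin K A C ρ k (g * f) = 0 := by
    intro f h g
    induction g using MvPolynomial.induction_on' with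
    | monomial u a =>
      have : monomial u a = a • monomial u (1 : K) := by rw [smul_monomial, smul_eq_mul, mul_one]
      rw [this, smul_mul_assoc, map_smul, h, smul_zero]
    | add g₁ g₂ h₁ h₂ => rw [add_mul, map_add, h₁, h₂, add_zero]
  rw [binomialIdeal] at hf
  induction hf using Submodule.span_induction with
  | mem f hf =>
    refine hmon f fun u => ?_
    rcases hf with ⟨a, ha, rfl⟩ | ⟨c, hc, b, hb, rfl⟩
    · rw [monomial_mul, one_mul, normalFormLin_monomial,
        normalForm_of_exists_left ⟨a, ha, le_add_self⟩]
    · rw [mul_sub, monomial_mul, monomial_mul, one_mul, map_sub, normalFormLin_monomial,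
        normalFormLin_monomial, sub_eq_zero]
      refine H.normalForm_eq hc le_add_self ?_
      rw [add_comm u, add_comm u]
      exact hb.add_right u
  | zero => simp
  | add f g _ _ hf hg => intro e; rw [mul_add, map_add, hf, hg, add_zero]
  | smul e f _ hf => intro g; rw [smul_eq_mul, ← mul_assoc]; exact hf _

/-- A nonzero polynomial in `X k` is a nonzerodivisor modulo a confluent binomial ideal: the
kernel of `normalFormLin` is the ideal, and its target is a domain. -/
theorem IsConfluent.mem_of_aeval_mul_mem (H : IsConfluent A C ρ k) {p : Polynomial K} (hp : p ≠ 0)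
    {f : MvPolynomial (Fin n) K} (hf : Polynomial.aeval (X k) p * f ∈ binomialIdeal K A C ρ) :
    f ∈ binomialIdeal K A C ρ := by
  have h := H.normalFormLin_eq_zero hf
  rw [H.normalFormLin_aeval_mul, mul_eq_zero] at h
  rcases h with h | h
  · have h' := congrArg (expandVar k) h
    rw [expandVar_aeval_X_self, map_zero, Polynomial.map_eq_zero_iff
      (FaithfulSMul.algebraMap_injective K (MvPolynomial (Fin n) K))] at h'
    exact absurd h' hp
  · simpa [h] using H.sub_normalFormLin_mem f

end NormalForm

/-! ### Borel sets -/

section Borel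

variable {n d : ℕ}

/-- Two vectors of the same degree are comparable in the Borel order if their partial sums are: the
differences of the partial sums are the coefficients of the `e k - e (k + 1)`. -/
theorem borelGE_of_sum_le {a b : Fin n →₀ ℕ} (hab : ∑ i, a i = ∑ i, b i)
    (h : ∀ t : ℕ, ∑ i : Fin n with i.val < t, b i ≤ ∑ i : Fin n with i.val < t, a i) : BorelGE a b := by
  set D : ℕ → ℤ := fun t =>
    (∑ i : Fin n with i.val < t, a i : ℕ) - (∑ i : Fin n with i.val < t, b i : ℕ) with hD
  have hD0 : D 0 = 0 := by simp [hD]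
  have hDn : D n = 0 := by
    simp only [hD, Fin.is_lt, Finset.filter_true]
    rw [hab, sub_self]
  have hDnn : ∀ t, 0 ≤ D t := fun t => sub_nonneg.2 (by exact_mod_cast h t)
  have hsucc : ∀ (f : Fin n →₀ ℕ) (i : Fin n), ∑ j : Fin n with j.val < i.val + 1, f j =
      f i + ∑ j : Fin n with j.val < i.val, f j := by
    intro f i
    rw [← Finset.sum_insert (s := {j : Fin n | j.val < i.val}) (by simp)]
    refine Finset.sum_congr ?_ fun _ _ => rfl
    ext j
    simp only [Finset.mem_filter, Finset.mem_univ, true_and, Finset.mem_insert, Fin.ext_iff]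
    omega
  have hDs : ∀ i : Fin n, (a i : ℤ) - b i = D (i + 1) - D i := fun i => by
    simp only [hD, hsucc]
    push_cast
    ring
  refine ⟨fun k => (D (k + 1)).toNat, fun i => ?_⟩
  rw [hDs]
  have hterm : ∀ k, (((D (k + 1)).toNat : ℕ) : ℤ) * (stdVec n k i - stdVec n (k + 1) i) =
      (if (i : ℕ) = k then D (k + 1) else 0) - (if (i : ℕ) = k + 1 then D (k + 1) else 0) := by
    intro k
    rw [Int.toNat_of_nonneg (hDnn _), mul_sub, stdVec, stdVec]
    simp only [mul_ite, mul_one, mul_zero]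
  rw [Finset.sum_congr rfl fun k _ => hterm k, Finset.sum_sub_distrib, Finset.sum_ite_eq]
  have h₁ : (if (i : ℕ) ∈ Finset.range (n - 1) then D (i + 1) else 0) = D (i + 1) := by
    split_ifs with hi
    · rfl
    · rw [Finset.mem_range] at hi
      have : (i : ℕ) + 1 = n := by omega
      rw [this, hDn]
  have h₂ : ∑ k ∈ Finset.range (n - 1), (if (i : ℕ) = k + 1 then D (k + 1) else 0) = D i := by
    obtain hi | ⟨j, hj⟩ : (i : ℕ) = 0 ∨ ∃ j, (i : ℕ) = j + 1 := by
      rcases Nat.eq_zero_or_eq_succ_pred (i : ℕ) with h | h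
      · exact Or.inl h
      · exact Or.inr ⟨_, h⟩
    · rw [hi, hD0]
      exact Finset.sum_eq_zero fun k _ => if_neg (by omega)
    · rw [Finset.sum_eq_single j]
      · rw [if_pos hj, hj]
      · intro k _ hk
        exact if_neg (by omega)
      · intro hj'
        rw [Finset.mem_range] at hj'
        omega
  rw [h₁, h₂]

/-- A vector with no entries beyond the position `m` that dominates `b` before the position `m` is
Borel-larger than `b`. -/
theorem IsBorelSet.mem_of_forall_le {B : Set (Fin n →₀ ℕ)} (hB : IsBorelSet d B)
    {b v : Fin n →₀ ℕ} (hb : b ∈ B) (hv : v ∈ vectorsOfDegree n d) (m : Fin n)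
    (hgt : ∀ i, m < i → v i = 0) (hlt : ∀ i < m, b i ≤ v i) : v ∈ B := by
  have hbd : ∑ i, b i = d := hB.1 hb
  have hvd : ∑ i, v i = d := hv
  refine hB.2 b hb v hv (borelGE_of_sum_le (hvd.trans hbd.symm) fun t => ?_)
  by_cases ht : t ≤ m
  · refine Finset.sum_le_sum fun i hi => hlt i ?_
    rw [Finset.mem_filter] at hi
    exact Fin.lt_def.2 (hi.2.trans_le ht)
  · have : ∑ i : Fin n with i.val < t, v i = ∑ i, v i := by
      refine Finset.sum_subset (Finset.filter_subset _ _) fun i _ hi => hgt i ?_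
      simp only [Finset.mem_filter, Finset.mem_univ, true_and] at hi
      exact Fin.lt_def.2 (by omega)
    rw [this, hvd, ← hbd]
    exact Finset.sum_le_sum_of_subset (Finset.filter_subset _ _)

/-- A Borel set contains the vectors that arise from its elements by moving `s` units from a
position `j` to a position `i ≤ j`. -/
theorem IsBorelSet.mem_of_add_single_eq {B : Set (Fin n →₀ ℕ)} (hB : IsBorelSet d B)
    {b v : Fin n →₀ ℕ} (hb : b ∈ B) {i j : Fin n} (hij : i ≤ j) {s : ℕ}
    (h : v + Finsupp.single j s = b + Finsupp.single i s) : v ∈ B := by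
  have hap : ∀ l, v l + Finsupp.single j s l = b l + Finsupp.single i s l := fun l =>
    DFunLike.congr_fun h l
  have hsum : ∀ S : Finset (Fin n), ∑ l ∈ S, v l + (if j ∈ S then s else 0) =
      ∑ l ∈ S, b l + (if i ∈ S then s else 0) := by
    intro S
    have := Finset.sum_congr rfl fun l (_ : l ∈ S) => hap l
    simpa [Finset.sum_add_distrib, Finsupp.single_apply] using this
  have hvb : ∑ l, v l = ∑ l, b l := by simpa using hsum Finset.univ
  refine hB.2 b hb v (hvb.trans (hB.1 hb)) (borelGE_of_sum_le hvb fun t => ?_)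
  have := hsum (Finset.univ.filter fun l => (l : ℕ) < t)
  simp only [Finset.mem_filter, Finset.mem_univ, true_and] at this
  rw [Fin.le_def] at hij
  split_ifs at this <;> omega

theorem exists_add_single_eq {b : Fin n →₀ ℕ} (i : Fin n) {j : Fin n} {s : ℕ} (h : s ≤ b j) :
    ∃ v, v + Finsupp.single j s = b + Finsupp.single i s := by
  refine ⟨b - Finsupp.single j s + Finsupp.single i s, ?_⟩
  rw [add_right_comm, tsub_add_cancel_of_le (Finsupp.single_le_iff.2 h)]

/-- The vector `b` with the entries at the positions `≥ t` replaced by zero. -/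
noncomputable def trunc (t : ℕ) (b : Fin n →₀ ℕ) : Fin n →₀ ℕ := b.filter fun i => (i : ℕ) < t

theorem trunc_apply (t : ℕ) (b : Fin n →₀ ℕ) (i : Fin n) :
    trunc t b i = if (i : ℕ) < t then b i else 0 := Finsupp.filter_apply _ _ _

theorem trunc_le (t : ℕ) (b : Fin n →₀ ℕ) : trunc t b ≤ b := fun i => by
  rw [trunc_apply]; split_ifs <;> simp

theorem trunc_eq_self {t : ℕ} (ht : n ≤ t) (b : Fin n →₀ ℕ) : trunc t b = b := by
  ext i
  rw [trunc_apply, if_pos (i.2.trans_le ht)]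

/-- If `v` arises from `b` by moving the whole entry at `t` to a position `i ≤ t`, then `v` and `b`
have, up to the entry moved, the same truncation. -/
theorem trunc_succ_of_add_single_eq {b v : Fin n →₀ ℕ} {i t : Fin n} (hit : i ≤ t)
    (h : v + Finsupp.single t (b t) = b + Finsupp.single i (b t)) :
    trunc (t + 1) v = trunc t b + Finsupp.single i (b t) := by
  ext l
  have hl := DFunLike.congr_fun h l
  have hit' := Fin.le_def.1 hit
  simp only [trunc_apply, Finsupp.add_apply, Finsupp.single_apply, Fin.ext_iff] at hl ⊢
  by_cases hlt : (l : ℕ) = t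
  · have : l = t := Fin.ext hlt
    subst this
    simp only [if_true, lt_irrefl, if_false, lt_add_iff_pos_right, zero_lt_one] at hl ⊢
    omega
  · split_ifs at hl ⊢ <;> omega

end Borel

/-! ### Admissible binomial systems -/

section Systems

variable {n d : ℕ} {A C : Set (Fin n →₀ ℕ)} {ρ : Fin n → ℤ}

theorem apply_le_of_mem_vectorsOfDegree {b : Fin n →₀ ℕ} (hb : b ∈ vectorsOfDegree n d)
    (i : Fin n) : b i ≤ d := by
  have h : ∑ i, b i = d := hb
  rw [← h]
  exact Finset.single_le_sum (f := fun i => b i) (fun _ _ => Nat.zero_le _) (Finset.mem_univ i)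

theorem IsBinomialSystem.mem_left_of_mem_of_mem_translate (h : IsBinomialSystem d A C ρ)
    {b : Fin n →₀ ℕ} (h₁ : b ∈ A ∪ C) (h₂ : b ∈ A ∪ translate C ρ) : b ∈ A := by
  rcases h₁ with h₁ | h₁
  · exact h₁
  rcases h₂ with h₂ | h₂
  · exact h₂
  · exact absurd (h.disjoint_right ▸ (⟨h₁, h₂⟩ : b ∈ C ∩ translate C ρ)) (Set.notMem_empty b)

/-- The set `A` is the intersection of the Borel sets `A ∪ C` and `A ∪ (C + ρ)`. -/
theorem IsBinomialSystem.isBorelSet_left (h : IsBinomialSystem d A C ρ) : IsBorelSet d A :=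
  ⟨h.subset_left, fun a ha b hb hba => h.mem_left_of_mem_of_mem_translate
    (h.borel_left.2 a (Or.inl ha) b hb hba) (h.borel_right.2 a (Or.inl ha) b hb hba)⟩

/-- If `b ∈ A` and `b + ρ ∈ A ∪ (C + ρ)`, then `b + ρ ∈ A`, since otherwise `b ∈ A ∩ C`. -/
theorem IsBinomialSystem.mem_left_of_isTranslate (h : IsBinomialSystem d A C ρ)
    {b b' : Fin n →₀ ℕ} (hb : b ∈ A) (hbb' : IsTranslate ρ b b') (hb' : b' ∈ A ∪ translate C ρ) :
    b' ∈ A := by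
  rcases hb' with hb' | ⟨c, hc, hcb'⟩
  · exact hb'
  · rw [hcb'.unique_left hbb'] at hc
    exact absurd (h.disjoint_left ▸ (⟨hb, hc⟩ : b ∈ A ∩ C)) (Set.notMem_empty b)

/-- The vectors `c` and `c + ρ` have the same degree. -/
theorem IsBinomialSystem.sum_eq_zero (h : IsBinomialSystem d A C ρ) {c : Fin n →₀ ℕ}
    (hc : c ∈ C) : ∑ i, ρ i = 0 := by
  obtain ⟨b, hb, hcb⟩ := h.translate_mem c hc
  have h₁ : ∑ i, c i = d := h.subset_right hc
  have h₂ : ∑ i, b i = d := hb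
  have h₃ : (∑ i, (b i : ℤ)) = ∑ i, ((c i : ℤ) + ρ i) := Finset.sum_congr rfl fun i _ => hcb i
  rw [Finset.sum_add_distrib] at h₃
  have h₄ : (∑ i, (b i : ℤ)) = ∑ i, (c i : ℤ) := by exact_mod_cast h₂.trans h₁.symm
  linarith

theorem IsBinomialSystem.subset_vectorsOfDegree (h : IsBinomialSystem d A C ρ) :
    A ∪ C ∪ translate C ρ ⊆ vectorsOfDegree n d :=
  Set.union_subset h.borel_left.1 (Set.subset_union_right.trans h.borel_right.1)

theorem IsBinomialSystem.mem_of_add_single_eq (h : IsBinomialSystem d A C ρ)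
    {b v : Fin n →₀ ℕ} (hb : b ∈ A ∪ C ∪ translate C ρ) {i j : Fin n} (hij : i ≤ j) {s : ℕ}
    (hv : v + Finsupp.single j s = b + Finsupp.single i s) : v ∈ A ∪ C ∪ translate C ρ := by
  rcases hb with hb | hb
  · exact Or.inl (h.borel_left.mem_of_add_single_eq hb hij hv)
  · rcases h.borel_right.mem_of_add_single_eq (Or.inr hb) hij hv with h' | h'
    · exact Or.inl (Or.inl h')
    · exact Or.inr h'

variable [NeZero n]

theorem apply_eq_zero_of_lastIndex_lt {i : Fin n} (hi : lastIndex ρ < i) : ρ i = 0 := by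
  by_contra hne
  refine absurd (Finset.le_max' _ i ?_) (not_le.2 hi)
  exact Finset.mem_insert_of_mem (Finset.mem_filter.2 ⟨Finset.mem_univ _, hne⟩)

theorem IsAdmissibleBinomialSystem.pos (h : IsAdmissibleBinomialSystem d A C ρ)
    {c : Fin n →₀ ℕ} (hc : c ∈ C) : 0 < ρ (lastIndex ρ) :=
  h.admissible.resolve_left fun h0 => by simp [h0] at hc

theorem IsAdmissibleBinomialSystem.nonneg (h : IsAdmissibleBinomialSystem d A C ρ)
    {c : Fin n →₀ ℕ} (hc : c ∈ C) {i : Fin n} (hi : lastIndex ρ ≤ i) : 0 ≤ ρ i := by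
  rcases hi.eq_or_lt with rfl | hi
  · exact (h.pos hc).le
  · exact (apply_eq_zero_of_lastIndex_lt hi).ge

theorem IsAdmissibleBinomialSystem.exists_isTranslate_trunc
    (h : IsAdmissibleBinomialSystem d A C ρ) {c : Fin n →₀ ℕ} (hc : c ∈ C) {t : ℕ}
    (ht : lastIndex ρ ≤ t) : ∃ b, IsTranslate ρ (trunc t c) b := by
  obtain ⟨b, -, hb⟩ := h.translate_mem c hc
  refine ⟨_, isTranslate_shift fun i => ?_⟩
  rw [trunc_apply]
  split_ifs with hi
  · rw [← hb i]; positivity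
  · have : 0 ≤ ρ i := h.nonneg hc (Fin.le_def.2 (by omega))
    simpa using this

/-- Truncations at the last index `m` of `ρ`: if `X ^ w` is divisible by the truncations of both
`c ∈ C` and `a ∈ A`, then `X ^ (w + ρ)` is divisible by the truncation of an element of `A`. Such
an element is obtained by filling up (part of) the truncation of `w + ρ` with a power of the
`m`-th variable: the result is Borel-larger than `c + ρ`, and so lies in `A` unless it
is a translate. If the truncation of `w` has degree at most `d`, it is the translate of an element
of `A` by the same construction; otherwise its entry at `m` is too small for a translate. -/
theorem IsAdmissibleBinomialSystem.exists_trunc_le_translate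
    (h : IsAdmissibleBinomialSystem d A C ρ) {a c w w' : Fin n →₀ ℕ} (ha : a ∈ A) (hc : c ∈ C)
    (haw : trunc (lastIndex ρ) a ≤ w) (hcw : trunc (lastIndex ρ) c ≤ w)
    (hw : IsTranslate ρ w w') : ∃ a' ∈ A, trunc (lastIndex ρ) a' ≤ w' := by
  set m := lastIndex ρ with hm
  obtain ⟨c', hc'd, hcc'⟩ := h.translate_mem c hc
  have hc' : c' ∈ A ∪ translate C ρ := Or.inr ⟨c, hc, hcc'⟩
  have hpos : 0 < ρ m := h.pos hc
  set u := trunc m w with hu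
  set u' := trunc m w' with hu'
  have hum : ∀ i, m ≤ i → u i = 0 := fun i hi => by
    rw [hu, trunc_apply, if_neg (not_lt.2 (Fin.le_def.1 hi))]
  have hum' : ∀ i, m ≤ i → u' i = 0 := fun i hi => by
    rw [hu', trunc_apply, if_neg (not_lt.2 (Fin.le_def.1 hi))]
  have hul : ∀ i, i < m → u i = w i := fun i hi => by
    rw [hu, trunc_apply, if_pos (Fin.lt_def.1 hi)]
  have hul' : ∀ i, i < m → u' i = w' i := fun i hi => by
    rw [hu', trunc_apply, if_pos (Fin.lt_def.1 hi)]
  have hle : ∀ (b x : Fin n →₀ ℕ), trunc m b ≤ x → ∀ i < m, b i ≤ x i := fun b x hb i hi => by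
    have := hb i
    rwa [trunc_apply, if_pos (Fin.lt_def.1 hi)] at this
  -- The vector `v` filled up to degree `d` at the position `m`.
  have fill : ∀ {B : Set (Fin n →₀ ℕ)}, IsBorelSet d B → ∀ b ∈ B, ∀ v : Fin n →₀ ℕ,
      (∀ i, m ≤ i → v i = 0) → v.degree ≤ d → (∀ i < m, b i ≤ v i) →
      v + Finsupp.single m (d - v.degree) ∈ B := by
    intro B hB b hb v hv hvd hbv
    refine hB.mem_of_forall_le hb ?_ m (fun i hi => ?_) fun i hi => (hbv i hi).trans ?_
    · have : (v + Finsupp.single m (d - v.degree)).degree = d := by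
        rw [map_add, Finsupp.degree_single]; omega
      rwa [Finsupp.degree_eq_sum] at this
    · simp [hv i hi.le, Finsupp.single_eq_of_ne hi.ne']
    · simp
  have htrunc : ∀ (v : Fin n →₀ ℕ) (s : ℕ), (∀ i, m ≤ i → v i = 0) →
      trunc m (v + Finsupp.single m s) = v := by
    intro v s hv
    ext i
    rw [trunc_apply]
    split_ifs with hi
    · simp [Finsupp.single_eq_of_ne (Fin.lt_def.2 hi : i < m).ne]
    · rw [hv i (Fin.le_def.2 (not_lt.1 hi))]
  have hdeg : (u'.degree : ℤ) = u.degree - ρ m := by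
    have h₁ : ∀ i, (u' i : ℤ) = u i + ρ i - if i = m then ρ m else 0 := by
      intro i
      rcases lt_trichotomy i m with hi | rfl | hi
      · rw [hul i hi, hul' i hi, hw i, if_neg hi.ne, sub_zero]
      · simp [hum, hum']
      · rw [hum i hi.le, hum' i hi.le, if_neg hi.ne', apply_eq_zero_of_lastIndex_lt hi]; simp
    rw [Finsupp.degree_eq_sum, Finsupp.degree_eq_sum]
    push_cast
    rw [Finset.sum_congr rfl fun i _ => h₁ i, Finset.sum_sub_distrib, Finset.sum_add_distrib,
      h.sum_eq_zero hc]
    simp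
  have hc'w' : ∀ i < m, c' i ≤ u' i := fun i hi => by
    have h₁ := hle c w hcw i hi
    have h₂ := hcc' i
    have h₃ := hw i
    rw [hul' i hi]
    omega
  by_cases hud : u.degree ≤ d
  -- The filled up `u'` is the translate of the filled up `u`, which lies in `A`.
  · have hcB := fill h.isBorelSet_left a ha u hum hud fun i hi =>
      (hle a w haw i hi).trans_eq (hul i hi).symm
    have hbB' := fill h.borel_right c' hc' u' hum' (by omega) hc'w'
    refine ⟨_, h.mem_left_of_isTranslate hcB (fun i => ?_) hbB', ?_⟩
    · simp only [Finsupp.add_apply, Finsupp.single_apply]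
      rcases lt_trichotomy i m with hi | rfl | hi
      · rw [hul i hi, hul' i hi, if_neg hi.ne', if_neg hi.ne']
        simpa using hw i
      · rw [hum _ le_rfl, hum' _ le_rfl, if_pos rfl, if_pos rfl]
        omega
      · rw [hum i hi.le, hum' i hi.le, if_neg hi.ne, if_neg hi.ne,
          apply_eq_zero_of_lastIndex_lt hi]
        simp
    · rw [htrunc _ _ hum']
      exact trunc_le _ _
  -- A vector between the truncation of `c'` and `u'` of degree `min d (deg u')` is filled up; its
  -- entry at `m` becomes smaller than `ρ m`.
  · have hc'u' : trunc m c' ≤ u' := fun i => by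
      rw [trunc_apply]
      split_ifs with hi
      · exact hc'w' i (Fin.lt_def.2 hi)
      · exact Nat.zero_le _
    obtain ⟨e, he⟩ := exists_add_of_le hc'u'
    have hc'deg : (trunc m c').degree ≤ d := by
      have h₁ : c'.degree = d := by rw [Finsupp.degree_eq_sum]; exact hc'd
      rw [← h₁]
      exact Finsupp.degree_mono (trunc_le _ _)
    have hdegs : u'.degree = (trunc m c').degree + e.degree := by rw [he, map_add]
    obtain ⟨g, hge, hg⟩ := Finsupp.exists_le_degree_eq e
      (min d u'.degree - (trunc m c').degree) (by omega)
    set v := trunc m c' + g with hv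
    have hvdeg : v.degree = min d u'.degree := by
      rw [hv, map_add, hg]; omega
    have hvu' : v ≤ u' := by rw [hv, he]; gcongr
    have hvm : ∀ i, m ≤ i → v i = 0 := fun i hi =>
      Nat.le_zero.1 ((hvu' i).trans_eq (hum' i hi))
    have hbB' := fill h.borel_right c' hc' v hvm (by omega)
      (hle c' v (hv ▸ le_self_add))
    rcases hbB' with hb | ⟨x, -, hx⟩
    · exact ⟨_, hb, by rw [htrunc _ _ hvm]; exact hvu'.trans (trunc_le _ _)⟩
    · have := hx m
      simp only [Finsupp.add_apply, Finsupp.single_apply, hvm m le_rfl, if_true] at this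
      omega

theorem IsAdmissibleBinomialSystem.isConfluent (h : IsAdmissibleBinomialSystem d A C ρ) :
    IsConfluent (trunc (lastIndex ρ) '' A) (trunc (lastIndex ρ) '' C) ρ (lastIndex ρ) where
  left_apply := by
    rintro _ ⟨a, -, rfl⟩
    rw [trunc_apply, if_neg (lt_irrefl _)]
  right_apply := by
    rintro _ ⟨a, -, rfl⟩
    rw [trunc_apply, if_neg (lt_irrefl _)]
  nonneg := by
    rintro _ ⟨c, hc, rfl⟩ i
    obtain ⟨b, hb⟩ := h.exists_isTranslate_trunc hc le_rfl
    rw [← hb i]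
    positivity
  pos := by
    rintro _ ⟨c, hc, rfl⟩
    exact h.pos hc
  sum_eq_zero := by
    rintro _ ⟨c, hc, rfl⟩
    exact h.sum_eq_zero hc
  overlap := by
    rintro _ ⟨c, hc, rfl⟩ _ ⟨a, ha, rfl⟩ w w' hcw haw hw
    obtain ⟨a', ha', hle⟩ := h.exists_trunc_le_translate ha hc haw hcw hw
    exact ⟨_, ⟨a', ha', rfl⟩, hle⟩

end Systems

/-! ### The chain of partial saturations -/

section PartialSaturation

variable {n d : ℕ} {A C : Set (Fin n →₀ ℕ)} {ρ : Fin n → ℤ} {K : Type*} [Field K]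

theorem monomial_mem_of_le {J : Ideal (MvPolynomial (Fin n) K)} {a w : Fin n →₀ ℕ}
    (ha : monomial a (1 : K) ∈ J) (haw : a ≤ w) : monomial w (1 : K) ∈ J := by
  obtain ⟨u, rfl⟩ := exists_add_of_le haw
  have : monomial (a + u) (1 : K) = monomial u 1 * monomial a 1 := by
    rw [monomial_mul, one_mul, add_comm]
  rw [this]
  exact Ideal.mul_mem_left _ _ ha

theorem mul_mem_of_mem_binomialIdeal {J : Ideal (MvPolynomial (Fin n) K)} {u : Fin n →₀ ℕ}
    (hA : ∀ a ∈ A, monomial (u + a) (1 : K) ∈ J)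
    (hC : ∀ c ∈ C, ∀ b, IsTranslate ρ c b →
      monomial (u + c) (1 : K) - monomial (u + b) 1 ∈ J) {f : MvPolynomial (Fin n) K}
    (hf : f ∈ binomialIdeal K A C ρ) : monomial u 1 * f ∈ J := by
  rw [binomialIdeal] at hf
  induction hf using Submodule.span_induction with
  | mem f hf =>
    rcases hf with ⟨a, ha, rfl⟩ | ⟨c, hc, b, hb, rfl⟩
    · rw [monomial_mul, one_mul]
      exact hA a ha
    · rw [mul_sub, monomial_mul, monomial_mul, one_mul]
      exact hC c hc b hb
  | zero => simp
  | add f g _ _ hf hg => rw [mul_add]; exact add_mem hf hg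
  | smul e f _ hf => rw [smul_eq_mul, mul_left_comm]; exact J.mul_mem_left _ hf

theorem isExtended_binomialIdeal {i : Fin n} (hA : ∀ a ∈ A, a i = 0) (hC : ∀ c ∈ C, c i = 0)
    (hρ : ∀ c ∈ C, ρ i = 0) : IsExtended i (binomialIdeal K A C ρ) := by
  refine isExtended_span ?_
  rintro _ (⟨a, ha, rfl⟩ | ⟨c, hc, b, hb, rfl⟩)
  · exact expandVar_monomial (hA a ha)
  · have hbi : b i = 0 := by
      have := hb i
      rw [hC c hc, hρ c hc] at this
      exact_mod_cast this
    rw [map_sub, map_sub, expandVar_monomial (hC c hc), expandVar_monomial hbi]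

theorem isHomogeneous_binomialIdeal (hρ : ∀ c ∈ C, ∑ i, ρ i = 0) :
    (binomialIdeal K A C ρ).IsHomogeneous (homogeneousSubmodule (Fin n) K) := by
  refine Ideal.homogeneous_span _ _ ?_
  rintro _ (⟨a, ha, rfl⟩ | ⟨c, hc, b, hb, rfl⟩)
  · exact ⟨_, isHomogeneous_monomial 1 rfl⟩
  · refine ⟨c.degree, (isHomogeneous_monomial 1 rfl).sub (isHomogeneous_monomial 1 ?_)⟩
    have : (∑ i, (b i : ℤ)) = ∑ i, (c i : ℤ) := by
      rw [Finset.sum_congr rfl fun i _ => hb i, Finset.sum_add_distrib, hρ c hc, add_zero]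
    rw [Finsupp.degree_eq_sum, Finsupp.degree_eq_sum]
    exact_mod_cast this

variable [NeZero n]

/-- The ideal obtained from `binomialIdeal K A C ρ` by setting the variables at the positions `≥ t`
equal to one in the generators and multiplying the translates by the appropriate power of the
variable at the last index of `ρ`; for `t` below this index the binomials `X ^ c - X ^ (c + ρ)`
are first replaced by the pairs of monomials `X ^ c`, `X ^ (c + ρ)`. For an admissible system this is the
result of successive saturation with respect to the ideals `(X 0, …, X s)`,
`s = n - 1, n - 2, …, t`. -/
noncomputable def partialSaturation (K : Type*) [Field K] (A C : Set (Fin n →₀ ℕ))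
    (ρ : Fin n → ℤ) (t : ℕ) : Ideal (MvPolynomial (Fin n) K) :=
  if (lastIndex ρ : ℕ) ≤ t then binomialIdeal K (trunc t '' A) (trunc t '' C) ρ
  else binomialIdeal K (trunc t '' (A ∪ C ∪ translate C ρ)) ∅ ρ

theorem partialSaturation_of_le {t : ℕ} (ht : (lastIndex ρ : ℕ) ≤ t) :
    partialSaturation K A C ρ t = binomialIdeal K (trunc t '' A) (trunc t '' C) ρ := if_pos ht

theorem partialSaturation_of_lt {t : ℕ} (ht : t < (lastIndex ρ : ℕ)) :
    partialSaturation K A C ρ t = binomialIdeal K (trunc t '' (A ∪ C ∪ translate C ρ)) ∅ ρ :=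
  if_neg (not_le.2 ht)

theorem partialSaturation_self : partialSaturation K A C ρ n = binomialIdeal K A C ρ := by
  have himage : ∀ B : Set (Fin n →₀ ℕ), trunc n '' B = B := fun B => by
    simp [Set.image, trunc_eq_self le_rfl]
  rw [partialSaturation_of_le (lastIndex ρ).2.le, himage, himage]

theorem monomial_mem_partialSaturation {t : ℕ} {a w : Fin n →₀ ℕ} (ha : a ∈ A)
    (haw : trunc t a ≤ w) : monomial w (1 : K) ∈ partialSaturation K A C ρ t := by
  rw [partialSaturation]
  split_ifs with ht
  · exact monomial_mem_binomialIdeal ⟨a, ha, rfl⟩ haw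
  · exact monomial_mem_binomialIdeal ⟨a, Or.inl (Or.inl ha), rfl⟩ haw

theorem monomial_mem_partialSaturation_of_lt {t : ℕ} (ht : t < (lastIndex ρ : ℕ))
    {b w : Fin n →₀ ℕ} (hb : b ∈ A ∪ C ∪ translate C ρ) (hbw : trunc t b ≤ w) :
    monomial w (1 : K) ∈ partialSaturation K A C ρ t := by
  rw [partialSaturation_of_lt ht]
  exact monomial_mem_binomialIdeal ⟨b, hb, rfl⟩ hbw

theorem isExtended_partialSaturation {t : ℕ} {i : Fin n} (hti : t ≤ i)
    (hi : i ≠ lastIndex ρ ∨ t ≠ i) : IsExtended i (partialSaturation K A C ρ t) := by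
  have h0 : ∀ B : Set (Fin n →₀ ℕ), ∀ a ∈ trunc t '' B, a i = 0 := by
    rintro B _ ⟨a, -, rfl⟩
    rw [trunc_apply, if_neg (not_lt.2 hti)]
  rw [partialSaturation]
  split_ifs with ht
  · refine isExtended_binomialIdeal (h0 A) (h0 C) fun _ _ => apply_eq_zero_of_lastIndex_lt ?_
    refine lt_of_le_of_ne (Fin.le_def.2 (ht.trans hti)) ?_
    rintro rfl
    exact hi.elim (fun h => h rfl) fun h => h (le_antisymm hti ht)
  · exact isExtended_binomialIdeal (h0 _) (by simp) (by simp)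

namespace IsAdmissibleBinomialSystem

theorem isHomogeneous_partialSaturation (h : IsAdmissibleBinomialSystem d A C ρ) (t : ℕ) :
    (partialSaturation K A C ρ t).IsHomogeneous (homogeneousSubmodule (Fin n) K) := by
  rw [partialSaturation]
  split_ifs
  · refine isHomogeneous_binomialIdeal ?_
    rintro _ ⟨c, hc, rfl⟩
    exact h.sum_eq_zero hc
  · exact isHomogeneous_binomialIdeal (by simp)

/-- The first variable that is set to one in the generators is a nonzerodivisor modulo the
ideal: it does not occur in the generators unless it is at the last index of `ρ`, where the system
is confluent. -/
theorem mem_partialSaturation_of_aeval_mul_mem (h : IsAdmissibleBinomialSystem d A C ρ)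
    (t : Fin n) {p : Polynomial K} (hp : p ≠ 0) {f : MvPolynomial (Fin n) K}
    (hf : Polynomial.aeval (X t) p * f ∈ partialSaturation K A C ρ t) :
    f ∈ partialSaturation K A C ρ t := by
  by_cases ht : t = lastIndex ρ
  · subst ht
    rw [partialSaturation_of_le le_rfl] at hf ⊢
    exact h.isConfluent.mem_of_aeval_mul_mem hp hf
  · exact (isExtended_partialSaturation le_rfl (Or.inl ht)).mem_of_aeval_mul_mem hp hf

theorem antitone_partialSaturation (h : IsAdmissibleBinomialSystem d A C ρ) :
    Antitone (partialSaturation K A C ρ) := by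
  refine antitone_nat_of_succ_le fun t => ?_
  have hle : ∀ b : Fin n →₀ ℕ, trunc t b ≤ trunc (t + 1) b := fun b i => by
    rw [trunc_apply, trunc_apply]
    split_ifs <;> omega
  intro f hf
  suffices hs : monomial 0 1 * f ∈ partialSaturation K A C ρ t by
    rwa [show (monomial 0 (1 : K) : MvPolynomial (Fin n) K) = 1 from rfl, one_mul] at hs
  rcases lt_trichotomy (t + 1) (lastIndex ρ : ℕ) with ht | ht | ht
  · rw [partialSaturation_of_lt ht] at hf
    refine mul_mem_of_mem_binomialIdeal ?_ (by simp) hf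
    rintro _ ⟨b, hb, rfl⟩
    rw [zero_add]
    exact monomial_mem_partialSaturation_of_lt (by omega) hb (hle b)
  · rw [partialSaturation_of_le ht.ge] at hf
    refine mul_mem_of_mem_binomialIdeal ?_ ?_ hf
    · rintro _ ⟨a, ha, rfl⟩
      rw [zero_add]
      exact monomial_mem_partialSaturation ha (hle a)
    · rintro _ ⟨c, hc, rfl⟩ b hb
      rw [zero_add, zero_add]
      obtain ⟨c', -, hc'⟩ := h.translate_mem c hc
      refine sub_mem
        (monomial_mem_partialSaturation_of_lt (by omega) (Or.inl (Or.inr hc)) (hle c))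
        (monomial_mem_partialSaturation_of_lt (by omega) (Or.inr ⟨c, hc, hc'⟩) fun i => ?_)
      have h₁ := hb i
      have h₂ := hc' i
      rw [trunc_apply] at h₁ ⊢
      split_ifs at h₁ ⊢ <;> omega
  · rw [partialSaturation_of_le ht.le] at hf
    refine mul_mem_of_mem_binomialIdeal ?_ ?_ hf
    · rintro _ ⟨a, ha, rfl⟩
      rw [zero_add]
      exact monomial_mem_partialSaturation ha (hle a)
    · rintro _ ⟨c, hc, rfl⟩ b hb
      rw [zero_add, zero_add, partialSaturation_of_le (by omega)]
      obtain ⟨b', hb'⟩ := h.exists_isTranslate_trunc hc (t := t) (by omega)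
      obtain ⟨u, hu, hub⟩ := hb'.exists_of_le (hle c)
      exact binomial_mem_binomialIdeal ⟨c, hc, rfl⟩ hb' u hu (hb.unique_right hub)

/-- Moving the last entries to the position `i` turns an element of `A ∪ C` or of `A ∪ (C + ρ)` into
an element of the same Borel set, which lies in `A` if the last index of `ρ` is emptied in
an element of the second set. Hence a power of `X i` times the truncated monomial lies in the
binomial ideal. -/
theorem monomial_add_single_mem_partialSaturation (h : IsAdmissibleBinomialSystem d A C ρ)
    {v : Fin n →₀ ℕ} (hv : v ∈ A ∪ C ∪ translate C ρ) {i : Fin n} (hi : i < lastIndex ρ) :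
    monomial (trunc (lastIndex ρ) v + Finsupp.single i d) (1 : K) ∈
      partialSaturation K A C ρ (lastIndex ρ) := by
  set m := lastIndex ρ with hm
  -- For a translate the entry at `m` is emptied.
  have htr : ∀ v ∈ translate C ρ, monomial (trunc m v + Finsupp.single i d) (1 : K) ∈
      partialSaturation K A C ρ m := by
    intro v hv
    have hvd : v m ≤ d :=
      apply_le_of_mem_vectorsOfDegree (h.borel_right.1 (Or.inr hv)) m
    obtain ⟨w, hw⟩ := exists_add_single_eq i (le_refl (v m))
    have hwl : ∀ l, w l + Finsupp.single m (v m) l = v l + Finsupp.single i (v m) l :=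
      fun l => DFunLike.congr_fun hw l
    have hwA : w ∈ A := by
      rcases h.borel_right.mem_of_add_single_eq (Or.inr hv) hi.le hw with hwA | ⟨c, hc, hcw⟩
      · exact hwA
      · exfalso
        have h₁ := hwl m
        have h₂ := hcw m
        have h₃ := h.pos hc
        rw [Finsupp.single_eq_same, Finsupp.single_eq_of_ne hi.ne'] at h₁
        rw [← hm] at h₃
        omega
    refine monomial_mem_partialSaturation hwA fun l => ?_
    have h₁ := hwl l
    simp only [Finsupp.add_apply, trunc_apply, Finsupp.single_apply] at h₁ ⊢
    split_ifs at h₁ ⊢ <;> omega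
  rcases hv with (hv | hv) | hv
  · exact monomial_mem_partialSaturation hv le_self_add
  -- For `v ∈ C` the binomial generator reduces the claim to the translate.
  · obtain ⟨c', -, hc'⟩ := h.translate_mem v hv
    obtain ⟨b, hb⟩ := h.exists_isTranslate_trunc hv (le_refl (m : ℕ))
    have h₁ : monomial (trunc m v + Finsupp.single i d) (1 : K) -
        monomial (b + Finsupp.single i d) 1 ∈ partialSaturation K A C ρ m := by
      rw [partialSaturation_of_le le_rfl]
      exact binomial_mem_binomialIdeal ⟨v, hv, rfl⟩ hb (Finsupp.single i d) (add_comm _ _)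
        (add_comm _ _)
    have h₂ : monomial (b + Finsupp.single i d) (1 : K) ∈ partialSaturation K A C ρ m := by
      refine monomial_mem_of_le (htr c' ⟨v, hv, hc'⟩) ?_
      gcongr
      intro l
      have h₁ := hb l
      have h₂ := hc' l
      rw [trunc_apply] at h₁ ⊢
      split_ifs at h₁ ⊢ <;> omega
    simpa using add_mem h₁ h₂
  · exact htr v hv

/-- The exponent `2 * d` is needed for the step into the binomial range only, where first the entry at
`t` and then the entry at the last index of `ρ` is moved to `i`; otherwise `d` would do. -/
theorem X_pow_mul_mem_partialSaturation (h : IsAdmissibleBinomialSystem d A C ρ)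
    {i t : Fin n} (hit : i ≤ t) {f : MvPolynomial (Fin n) K}
    (hf : f ∈ partialSaturation K A C ρ t) :
    X i ^ (2 * d) * f ∈ partialSaturation K A C ρ (t + 1) := by
  rw [X_pow_eq_monomial]
  have hA : ∀ a ∈ A, monomial (Finsupp.single i (2 * d) + trunc t a) (1 : K) ∈
      partialSaturation K A C ρ (t + 1) := by
    intro a ha
    obtain ⟨v, hv⟩ := exists_add_single_eq i (le_refl (a t))
    refine monomial_mem_partialSaturation (h.isBorelSet_left.mem_of_add_single_eq ha hit hv) ?_
    have had := apply_le_of_mem_vectorsOfDegree (h.subset_left ha) t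
    rw [trunc_succ_of_add_single_eq hit hv, add_comm]
    gcongr
    omega
  rcases lt_trichotomy ((t : ℕ) + 1) (lastIndex ρ : ℕ) with ht | ht | ht
  · rw [partialSaturation_of_lt (by omega)] at hf
    refine mul_mem_of_mem_binomialIdeal ?_ (by simp) hf
    rintro _ ⟨b, hb, rfl⟩
    obtain ⟨v, hv⟩ := exists_add_single_eq i (le_refl (b t))
    refine monomial_mem_partialSaturation_of_lt ht (h.mem_of_add_single_eq hb hit hv) ?_
    have hbd := apply_le_of_mem_vectorsOfDegree (h.subset_vectorsOfDegree hb) t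
    rw [trunc_succ_of_add_single_eq hit hv, add_comm]
    gcongr
    omega
  · rw [partialSaturation_of_lt (by omega)] at hf
    refine mul_mem_of_mem_binomialIdeal ?_ (by simp) hf
    rintro _ ⟨b, hb, rfl⟩
    obtain ⟨v, hv⟩ := exists_add_single_eq i (le_refl (b t))
    have hbd := apply_le_of_mem_vectorsOfDegree (h.subset_vectorsOfDegree hb) t
    have hvt := trunc_succ_of_add_single_eq hit hv
    rw [ht] at hvt ⊢
    have hi : i < lastIndex ρ := Fin.lt_def.2 (by have := Fin.le_def.1 hit; omega)
    refine monomial_mem_of_le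
      (h.monomial_add_single_mem_partialSaturation (h.mem_of_add_single_eq hb hit hv) hi) ?_
    rw [hvt, add_assoc, ← Finsupp.single_add, add_comm]
    gcongr
    omega
  · have htm : lastIndex ρ ≤ t := Fin.le_def.2 (by omega)
    rw [partialSaturation_of_le (by omega)] at hf
    refine mul_mem_of_mem_binomialIdeal ?_ ?_ hf
    · rintro _ ⟨a, ha, rfl⟩
      exact hA a ha
    rintro _ ⟨c, hc, rfl⟩ b hb
    have hcd := apply_le_of_mem_vectorsOfDegree (h.subset_right hc) t
    obtain ⟨v, hv⟩ := exists_add_single_eq i (le_refl (c t))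
    have hvt := trunc_succ_of_add_single_eq hit hv
    have hsplit : Finsupp.single i (2 * d) =
        Finsupp.single i (2 * d - c t) + Finsupp.single i (c t) := by
      rw [← Finsupp.single_add]; congr 1; omega
    -- The move takes `c` to `v`. If `v ∈ A`, both terms of the product are in the ideal; if `v ∈ C`,
    -- the product is a multiple of the generator that belongs to `v`.
    rcases h.borel_left.mem_of_add_single_eq (Or.inr hc) hit hv with hvA | hvC
    · obtain ⟨c', -, hc'⟩ := h.translate_mem c hc
      have hρt := h.nonneg hc htm
      have hct : c t ≤ c' t := by have := hc' t; omega
      obtain ⟨v', hv'⟩ := exists_add_single_eq i hct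
      have hvv' : IsTranslate ρ v v' := fun l => by
        have h₁ := DFunLike.congr_fun hv l
        have h₂ := DFunLike.congr_fun hv' l
        have h₃ := hc' l
        simp only [Finsupp.add_apply] at h₁ h₂
        omega
      have hv'A := h.mem_left_of_isTranslate hvA hvv'
        (h.borel_right.mem_of_add_single_eq (Or.inr ⟨c, hc, hc'⟩) hit hv')
      refine sub_mem (monomial_mem_partialSaturation hvA ?_)
        (monomial_mem_partialSaturation hv'A fun l => ?_)
      · rw [hvt, add_comm]
        gcongr
        omega
      · have h₁ := hb l
        have h₂ := DFunLike.congr_fun hv' l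
        have h₃ := hc' l
        have hit' := Fin.le_def.1 hit
        simp only [Finsupp.add_apply, trunc_apply, Finsupp.single_apply, Fin.ext_iff] at h₁ h₂ ⊢
        by_cases hlt : (l : ℕ) = t
        · have : l = t := Fin.ext hlt
          subst this
          split_ifs at h₁ h₂ ⊢ <;> omega
        · split_ifs at h₁ h₂ ⊢ <;> omega
    · rw [partialSaturation_of_le ht.le]
      refine binomial_mem_binomialIdeal ⟨v, hvC, rfl⟩ (b := b + Finsupp.single i (c t)) ?_
        (Finsupp.single i (2 * d - c t)) ?_ ?_
      · rw [hvt]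
        exact hb.add_right _
      · rw [hvt, hsplit, add_assoc, add_comm (trunc t c)]
      · rw [hsplit, add_assoc, add_comm b]

/-- The variables with index at least `t` are a regular sequence on `I / partialSaturation t`, if
they do not occur in generators of `I` except possibly for the first one. -/
theorem isRegularAlong_subquotient (h : IsAdmissibleBinomialSystem d A C ρ) {t : ℕ} (ht : t ≤ n)
    {I : Ideal (MvPolynomial (Fin n) K)} (hle : partialSaturation K A C ρ t ≤ I)
    (hI : ∀ i : Fin n, t < i → IsExtended i I)
    (hnil : ∀ i : Fin n, (i : ℕ) < t → ∃ N : ℕ, ∀ f ∈ I,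
      X i ^ N * f ∈ partialSaturation K A C ρ t) :
    IsRegularAlong K ((List.finRange n).drop t)
      (Subquotient I (partialSaturation K A C ρ t)) where
  nilpotent i hi := by
    obtain ⟨N, hN⟩ := hnil i (by
      by_contra hti
      refine hi (List.mem_drop_iff_getElem.2 ⟨i - t, ?_, ?_⟩)
      · simp; omega
      · simp only [List.getElem_finRange, Fin.ext_iff, Fin.val_cast]
        omega)
    refine ⟨N, fun y => ?_⟩
    obtain ⟨y, rfl⟩ := Submodule.Quotient.mk_surjective _ y
    rw [← Submodule.Quotient.mk_smul, Submodule.Quotient.mk_eq_zero]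
    exact hN y y.2
  isWeaklyRegular p hp := by
    rcases ht.eq_or_lt with rfl | ht
    · rw [List.drop_eq_nil_of_le (by simp)]
      exact RingTheory.Sequence.IsWeaklyRegular.nil _ _
    have hdrop : (List.finRange n).drop t = (⟨t, ht⟩ : Fin n) :: (List.finRange n).drop (t + 1) := by
      rw [List.drop_eq_getElem_cons (by simpa using ht)]
      simp
    have hmem : ∀ j ∈ (List.finRange n).drop (t + 1), t < j := by
      intro j hj
      obtain ⟨k, hk, rfl⟩ := List.mem_drop_iff_getElem.1 hj
      simp
      omega
    have hnd : ((List.finRange n).drop t).Nodup :=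
      (List.nodup_finRange n).sublist (List.drop_sublist _ _)
    rw [hdrop] at hnd ⊢
    exact isWeaklyRegular_subquotient p hp hnd hle (fun j hj => hI j (hmem j hj))
      (fun j hj => isExtended_partialSaturation (hmem j hj).le (Or.inr (hmem j hj).ne))
      fun f hf => h.mem_partialSaturation_of_aeval_mul_mem ⟨t, ht⟩ (hp _) hf

/-- The filtration consists of the images of the ideals `partialSaturation K A C ρ s`, `s = t, …, 0`,
and of the unit ideal, without repetitions. -/
theorem isSequentiallyCohenMacaulay_partialSaturation (h : IsAdmissibleBinomialSystem d A C ρ)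
    {t : ℕ} (ht : t ≤ n) : IsSequentiallyCohenMacaulay (homogeneousSubmodule (Fin n) K)
      (quotientGrading (partialSaturation K A C ρ t)) := by
  set G : ℕ → Ideal (MvPolynomial (Fin n) K) := fun i =>
    if i ≤ t then partialSaturation K A C ρ (t - i) else ⊤ with hG
  have hGle : ∀ i ≤ t, G i = partialSaturation K A C ρ (t - i) := fun i hi => if_pos hi
  have hGgt : ∀ i, t < i → G i = ⊤ := fun i hi => if_neg (not_le.2 hi)
  refine isSequentiallyCohenMacaulay_quotientGrading G (t + 1) (hGle 0 (Nat.zero_le _))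
    (hGgt _ (Nat.lt_succ_self t)) (monotone_nat_of_le_succ fun i => ?_) (fun i _ => ?_)
    (fun i => (List.finRange n).drop (t - i))
    (fun i _ => (List.nodup_finRange n).sublist (List.drop_sublist _ _))
    (D := fun i => n - t + i) (fun i j hij => Nat.add_lt_add_left hij _) (fun i hi => ?_)
    (fun i hi => ?_)
  · by_cases hi : i + 1 ≤ t
    · rw [hGle i (by omega), hGle _ hi]
      exact h.antitone_partialSaturation (by omega)
    · rw [hGgt (i + 1) (by omega)]
      exact le_top
  · by_cases hi : i ≤ t
    · rw [hGle i hi]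
      exact h.isHomogeneous_partialSaturation _
    · rw [hGgt i (by omega)]
      exact fun _ _ _ => Submodule.mem_top
  · rw [List.length_drop, List.length_finRange]
    omega
  · rw [hGle i (by omega)]
    rcases Nat.lt_succ_iff_lt_or_eq.1 hi with hi | rfl
    · obtain ⟨s, hs⟩ : ∃ s, t - i = s + 1 := ⟨t - i - 1, by omega⟩
      rw [hGle (i + 1) hi, hs, show t - (i + 1) = s by omega]
      refine h.isRegularAlong_subquotient (by omega)
        (h.antitone_partialSaturation (Nat.le_succ s))
        (fun j hj => isExtended_partialSaturation (by omega) (Or.inr (by omega)))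
        fun j hj => ⟨2 * d, fun f hf => ?_⟩
      exact h.X_pow_mul_mem_partialSaturation (t := ⟨s, by omega⟩)
        (Fin.le_def.2 (Nat.lt_succ_iff.1 hj)) hf
    · rw [hGgt _ (Nat.lt_succ_self i)]
      exact h.isRegularAlong_subquotient (by omega) le_top (fun _ _ => isExtended_top)
        fun j hj => absurd hj (by omega)

/-- The ideal on the right is multiplied into `F` by a power of the irrelevant ideal, and the last
variable is a nonzerodivisor modulo it. -/
theorem saturation_binomialIdeal (h : IsAdmissibleBinomialSystem d A C ρ) :
    saturation (binomialIdeal K A C ρ) = partialSaturation K A C ρ (n - 1) := by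
  have hn : n - 1 < n := Nat.sub_lt (NeZero.pos n) one_pos
  have hn1 : n - 1 + 1 = n := by omega
  ext f
  rw [mem_saturation, ← partialSaturation_self]
  constructor
  · rintro ⟨k, hk⟩
    refine h.mem_partialSaturation_of_aeval_mul_mem ⟨n - 1, hn⟩
      (p := Polynomial.X ^ k) (pow_ne_zero _ Polynomial.X_ne_zero)
      (h.antitone_partialSaturation (Nat.sub_le n 1) ?_)
    rw [map_pow, Polynomial.aeval_X, mul_comm]
    have hX : (X ⟨n - 1, hn⟩ : MvPolynomial (Fin n) K) ∈ idealOfVars (Fin n) K :=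
      Ideal.subset_span ⟨_, rfl⟩
    exact hk _ (Ideal.pow_mem_pow hX k)
  · intro hf
    have hrad : idealOfVars (Fin n) K ≤ (Submodule.colon (partialSaturation K A C ρ n)
        (partialSaturation K A C ρ (n - 1) : Set (MvPolynomial (Fin n) K))).radical := by
      refine Ideal.span_le.2 ?_
      rintro _ ⟨i, rfl⟩
      refine ⟨2 * d, Submodule.mem_colon.2 fun g hg => ?_⟩
      have := h.X_pow_mul_mem_partialSaturation (t := ⟨n - 1, hn⟩)
        (show i ≤ (⟨n - 1, hn⟩ : Fin n) from Fin.le_def.2 (Nat.le_sub_one_of_lt i.2)) hg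
      rwa [hn1] at this
    obtain ⟨k, hk⟩ := Ideal.exists_pow_le_of_le_radical_of_fg hrad (idealOfVars_fg _ _)
    refine ⟨k, fun g hg => ?_⟩
    rw [mul_comm]
    exact Submodule.mem_colon.1 (hk hg) f hf

end IsAdmissibleBinomialSystem

end PartialSaturation

end BinomialIdeals

theorem mainTheorem3 {K : Type*} [Field K] [CharZero K] {n d : ℕ} [NeZero n] (hd : 0 < d)
    (A C : Set (Fin n →₀ ℕ)) (ρ : Fin n → ℤ)
    (h : BinomialIdeals.IsAdmissibleBinomialSystem d A C ρ) :
    BinomialIdeals.IsSequentiallyCohenMacaulay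
        (MvPolynomial.homogeneousSubmodule (Fin n) K)
        (BinomialIdeals.quotientGrading
          (BinomialIdeals.saturation (BinomialIdeals.binomialIdeal K A C ρ))) ∧
      BinomialIdeals.IsSequentiallyCohenMacaulay
        (MvPolynomial.homogeneousSubmodule (Fin n) K)
        (BinomialIdeals.quotientGrading (BinomialIdeals.binomialIdeal K A C ρ)) := by
  refine ⟨?_, ?_⟩
  · rw [h.saturation_binomialIdeal]
    exact h.isSequentiallyCohenMacaulay_partialSaturation (Nat.sub_le n 1)
  · rw [← BinomialIdeals.partialSaturation_self]
    exact h.isSequentiallyCohenMacaulay_partialSaturation le_rfl
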